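/- Let $n \ge 1$ and $Q \in GL(n,\mathbb{C})$. Let $A_u(Q)$ be the universal unital $C^*$-algebra generated by elements $u_{ij}$ ($1 \le i,j \le n$) subject to the relations $$u^*u = I_n = uu^*, \qquad u^t Q \bar u Q^{-1} = I_n = Q \bar u Q^{-1} u^t,$$ where $u = (u_{ij})$, $\bar u = (u_{ij}^*)$. All compact quantum groups $G$ are given by full Woronowicz $C^*$-algebras $A_G$ with coproduct $\Delta : A_G \to A_G \otimes A_G$ (minimal tensor product). A quantum subgroup $(N,\pi)$ of $G$ is a compact quantum group $N$ with a surjective unital $*$-homomorphism $\pi : A_G \to A_N$ such that $(\pi\otimes\pi)\Delta = \Delta\pi$. It is *normal* if $\{a : (\mathrm{id}\otimes\pi)\Delta(a) = a \otimes 1\} = \{a : (\pi\otimes \mathrm{id})\Delta(a) = 1\otimes a\}$, and *in the center* of $G$ if $(\pi\otimes\mathrm{id})\Delta = (\pi\otimes\mathrm{id})\sigma\Delta$, where $\sigma(a\otimes b) = b\otimes a$. $G$ is *connected* if the coefficients of every nontrivial irreducible unitary representation generate an infinite dimensional $C^*$-algebra. $G$ is *simple* if (1) $A_G$ is finitely generated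 (as a $C^*$-algebra, by the coefficients of a finite dimensional unitary representation); (2) $G$ is connected; (3) every connected normal quantum subgroup $(N,\pi)$ of $G$ is trivial, i.e. $A_N = \mathbb{C}$ or $\pi$ is an isomorphism; (4) $G$ has no nontrivial one-dimensional representation. Then $A_u(Q)$, with $\Delta(u_{ij}) = \sum_k u_{ik}\otimes u_{kj}$, is a compact quantum group that is not simple. Moreover, let $t \in C(\mathbb{T})$ be the coordinate function of the circle group $\mathbb{T}$, whose coproduct is given by $\Delta(t) = t\otimes t$. Then $\mathbb{T}$ is connected, and there is a unital $*$-homomorphism $\pi : A_u(Q) \to C(\mathbb{T})$ with $\pi(u_{ij}) = \delta_{ij}t$ which makes $(\mathbb{T},\pi)$ a quantum subgroup of $A_u(Q)$ that is in the center of $A_u(Q)$ and normal. -/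

import Mathlib

open scoped TensorProduct Matrix
open UniformSpace

noncomputable section

namespace QuantumGroup

universe u v w

set_option linter.checkUnivs false
set_option linter.unusedSectionVars false

/-! ### Enveloping C⋆-algebras -/

/-- A family of unital `⋆`-homomorphisms from a unital complex `⋆`-algebra `F` to C⋆-algebras
which is pointwise bounded. -/
structure RepFamily (F : Type u) [Ring F] [StarRing F] [Algebra ℂ F] [StarModule ℂ F] where
  Idx : Type v
  alg : Idx → Type w
  inst : ∀ i, CStarAlgebra (alg i)
  hom : ∀ i, F →⋆ₐ[ℂ] alg i
  bdd : ∀ x, ∃ C : ℝ, ∀ i, ‖hom i x‖ ≤ C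

attribute [instance] RepFamily.inst

namespace RepFamily

variable {F : Type u} [Ring F] [StarRing F] [Algebra ℂ F] [StarModule ℂ F]
variable (R : RepFamily.{u, v, w} F)

/-- The C⋆-seminorm `x ↦ sup_i ‖hom i x‖`. -/
def seminorm (x : F) : ℝ := ⨆ i, ‖R.hom i x‖

theorem le_seminorm (i : R.Idx) (x : F) : ‖R.hom i x‖ ≤ R.seminorm x := by
  obtain ⟨C, hC⟩ := R.bdd x
  exact le_ciSup (f := fun i => ‖R.hom i x‖) ⟨C, by rintro _ ⟨j, rfl⟩; exact hC j⟩ i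

theorem seminorm_nonneg (x : F) : 0 ≤ R.seminorm x :=
  Real.iSup_nonneg fun _ => norm_nonneg _

theorem seminorm_le {x : F} {C : ℝ} (hC : 0 ≤ C) (h : ∀ i, ‖R.hom i x‖ ≤ C) :
    R.seminorm x ≤ C := Real.iSup_le h hC

theorem seminorm_zero : R.seminorm 0 = 0 :=
  le_antisymm (R.seminorm_le le_rfl fun i => by simp) (R.seminorm_nonneg _)

theorem seminorm_neg (x : F) : R.seminorm (-x) = R.seminorm x := by simp [seminorm]

theorem seminorm_star (x : F) : R.seminorm (star x) = R.seminorm x := by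
  simp [seminorm, map_star]

theorem seminorm_smul_le (c : ℂ) (x : F) : R.seminorm (c • x) ≤ ‖c‖ * R.seminorm x :=
  R.seminorm_le (mul_nonneg (norm_nonneg _) (R.seminorm_nonneg _)) fun i => by
    rw [map_smul, norm_smul]
    exact mul_le_mul_of_nonneg_left (R.le_seminorm i x) (norm_nonneg _)

theorem seminorm_smul (c : ℂ) (x : F) : R.seminorm (c • x) = ‖c‖ * R.seminorm x := by
  refine le_antisymm (R.seminorm_smul_le c x) ?_
  by_cases hc : c = 0
  · rw [hc, norm_zero, zero_mul]; exact R.seminorm_nonneg _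
  · have := R.seminorm_smul_le c⁻¹ (c • x)
    rw [smul_smul, inv_mul_cancel₀ hc, one_smul, norm_inv] at this
    rwa [le_inv_mul_iff₀ (norm_pos_iff.mpr hc)] at this

theorem seminorm_add_le (x y : F) : R.seminorm (x + y) ≤ R.seminorm x + R.seminorm y :=
  R.seminorm_le (add_nonneg (R.seminorm_nonneg _) (R.seminorm_nonneg _)) fun i => by
    rw [map_add]
    exact (norm_add_le _ _).trans (add_le_add (R.le_seminorm i x) (R.le_seminorm i y))

theorem seminorm_mul_le (x y : F) : R.seminorm (x * y) ≤ R.seminorm x * R.seminorm y :=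
  R.seminorm_le (mul_nonneg (R.seminorm_nonneg _) (R.seminorm_nonneg _)) fun i => by
    rw [map_mul]
    exact (norm_mul_le _ _).trans
      (mul_le_mul (R.le_seminorm i x) (R.le_seminorm i y) (norm_nonneg _) (R.seminorm_nonneg _))

theorem seminorm_mul_self_le (x : F) :
    R.seminorm x * R.seminorm x ≤ R.seminorm (star x * x) := by
  have h : R.seminorm x ≤ Real.sqrt (R.seminorm (star x * x)) := by
    refine R.seminorm_le (Real.sqrt_nonneg _) fun i => Real.le_sqrt_of_sq_le ?_
    have := R.le_seminorm i (star x * x)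
    rwa [map_mul, map_star, CStarRing.norm_star_mul_self, ← pow_two] at this
  calc R.seminorm x * R.seminorm x
      ≤ Real.sqrt (R.seminorm (star x * x)) * Real.sqrt (R.seminorm (star x * x)) :=
        mul_self_le_mul_self (R.seminorm_nonneg _) h
    _ = _ := Real.mul_self_sqrt (R.seminorm_nonneg _)

/-- `F` equipped with the C⋆-seminorm of the family. -/
def Pre (_R : RepFamily.{u, v, w} F) : Type u := F

instance : Ring R.Pre := inferInstanceAs (Ring F)
instance : StarRing R.Pre := inferInstanceAs (StarRing F)
instance : Algebra ℂ R.Pre := inferInstanceAs (Algebra ℂ F)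
instance : StarModule ℂ R.Pre := inferInstanceAs (StarModule ℂ F)

instance : Norm R.Pre := ⟨R.seminorm⟩

theorem norm_pre (x : R.Pre) : ‖x‖ = R.seminorm x := rfl

theorem pre_core : SeminormedSpace.Core ℂ R.Pre where
  norm_nonneg := R.seminorm_nonneg
  norm_smul := R.seminorm_smul
  norm_triangle := R.seminorm_add_le

instance : SeminormedRing R.Pre where
  __ := (inferInstance : Ring R.Pre)
  __ := SeminormedAddCommGroup.ofCore R.pre_core
  norm_mul_le := R.seminorm_mul_le

instance : NormedAlgebra ℂ R.Pre where
  norm_smul_le := R.seminorm_smul_le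

theorem norm_star_pre (x : R.Pre) : ‖star x‖ = ‖x‖ := R.seminorm_star x

theorem uniformContinuous_star_pre : UniformContinuous (star : R.Pre → R.Pre) := by
  refine (AddMonoidHomClass.isometry_of_norm (starAddEquiv (R := R.Pre)) ?_).uniformContinuous
  exact R.norm_star_pre

/-- The enveloping C⋆-algebra of `F` with respect to the family: the Hausdorff completion of `F`
in the C⋆-seminorm `x ↦ sup_i ‖hom i x‖`. -/
def CStar (R : RepFamily.{u, v, w} F) : Type u := Completion R.Pre

instance : NormedRing R.CStar := inferInstanceAs (NormedRing (Completion R.Pre))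
instance : Algebra ℂ R.CStar := inferInstanceAs (Algebra ℂ (Completion R.Pre))
instance : CompleteSpace R.CStar := inferInstanceAs (CompleteSpace (Completion R.Pre))
instance : NormedAlgebra ℂ R.CStar where
  norm_smul_le := (inferInstance : NormedSpace ℂ (Completion R.Pre)).norm_smul_le

instance : Star R.CStar := ⟨Completion.map (star : R.Pre → R.Pre)⟩

/-- The canonical map, as a bare function. -/
def coe (x : F) : R.CStar := ((show R.Pre from x : R.Pre) : Completion R.Pre)

theorem denseRange_coe : DenseRange R.coe := Completion.denseRange_coe (α := R.Pre)

theorem star_coe (x : F) : star (R.coe x) = R.coe (star x) :=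
  Completion.map_coe R.uniformContinuous_star_pre _

theorem norm_coe (x : F) : ‖R.coe x‖ = R.seminorm x := Completion.norm_coe (E := R.Pre) x

theorem coe_add (x y : F) : R.coe (x + y) = R.coe x + R.coe y :=
  Completion.coe_add (α := R.Pre) x y

theorem coe_mul (x y : F) : R.coe (x * y) = R.coe x * R.coe y :=
  Completion.coe_mul (α := R.Pre) x y

theorem coe_smul (c : ℂ) (x : F) : R.coe (c • x) = c • R.coe x :=
  Completion.coe_smul (X := R.Pre) c x

theorem continuous_star_cstar : Continuous (star : R.CStar → R.CStar) :=
  Completion.continuous_map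

theorem induction {p : R.CStar → Prop} (hp : IsClosed {x | p x}) (h : ∀ x, p (R.coe x)) (x) :
    p x := R.denseRange_coe.induction_on x hp h

theorem norm_star_cstar (x : R.CStar) : ‖star x‖ = ‖x‖ := by
  have := R.continuous_star_cstar
  refine R.induction (p := fun x => ‖star x‖ = ‖x‖)
    (isClosed_eq (by fun_prop) (by fun_prop)) (fun x => ?_) x
  rw [star_coe, norm_coe, norm_coe, seminorm_star]

instance : StarRing R.CStar where
  star_involutive x := by
    have := R.continuous_star_cstar
    refine R.induction (p := fun x => star (star x) = x)
      (isClosed_eq (by fun_prop) (by fun_prop)) (fun x => ?_) x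
    rw [star_coe, star_coe, star_star]
  star_add x y := by
    have := R.continuous_star_cstar
    refine R.induction (p := fun x => star (x + y) = star x + star y)
      (isClosed_eq (by fun_prop) (by fun_prop)) (fun x => ?_) x
    refine R.induction (p := fun y => star (R.coe x + y) = star (R.coe x) + star y)
      (isClosed_eq (by fun_prop) (by fun_prop)) (fun y => ?_) y
    rw [← coe_add, star_coe, star_coe, star_coe, star_add, coe_add]
  star_mul x y := by
    have := R.continuous_star_cstar
    refine R.induction (p := fun x => star (x * y) = star y * star x)
      (isClosed_eq (by fun_prop) (by fun_prop)) (fun x => ?_) x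
    refine R.induction (p := fun y => star (R.coe x * y) = star y * star (R.coe x))
      (isClosed_eq (by fun_prop) (by fun_prop)) (fun y => ?_) y
    rw [← coe_mul, star_coe, star_coe, star_coe, star_mul, coe_mul]

instance : CStarRing R.CStar where
  norm_mul_self_le x := by
    have := R.continuous_star_cstar
    refine R.induction (p := fun x => ‖x‖ * ‖x‖ ≤ ‖star x * x‖)
      (isClosed_le (by fun_prop) (by fun_prop)) (fun x => ?_) x
    rw [star_coe, ← coe_mul, norm_coe, norm_coe]
    exact R.seminorm_mul_self_le x

instance : StarModule ℂ R.CStar where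
  star_smul c x := by
    have h := R.continuous_star_cstar
    refine R.induction (p := fun x => star (c • x) = star c • star x)
      (isClosed_eq (h.comp (continuous_const_smul c)) (h.const_smul (star c))) (fun x => ?_) x
    rw [← coe_smul, star_coe, star_coe, star_smul, coe_smul]

instance : CStarAlgebra R.CStar where

/-- The canonical `⋆`-homomorphism from `F` to its enveloping C⋆-algebra. -/
def of : F →⋆ₐ[ℂ] R.CStar where
  toFun := R.coe
  map_one' := Completion.coe_one (α := R.Pre)
  map_mul' := R.coe_mul
  map_zero' := Completion.coe_zero (α := R.Pre)
  map_add' := R.coe_add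
  commutes' c := by
    rw [Algebra.algebraMap_eq_smul_one, coe_smul, Algebra.algebraMap_eq_smul_one]
    congr 1
  map_star' x := (R.star_coe x).symm

theorem denseRange_of : DenseRange R.of := R.denseRange_coe

theorem norm_of (x : F) : ‖R.of x‖ = R.seminorm x := R.norm_coe x

variable {D : Type*} [CStarAlgebra D]

/-- The continuous extension of a contractive `⋆`-homomorphism, as a linear map. -/
def liftCLM (φ : F →⋆ₐ[ℂ] D) (h : ∀ x, ‖φ x‖ ≤ R.seminorm x) : R.CStar →L[ℂ] D :=
  ContinuousLinearMap.fromCompletion (α := R.Pre)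
    (LinearMap.mkContinuous (φ.toAlgHom.toLinearMap : R.Pre →ₗ[ℂ] D) 1
      fun x => by rw [one_mul]; exact h x)

theorem liftCLM_of (φ : F →⋆ₐ[ℂ] D) (h : ∀ x, ‖φ x‖ ≤ R.seminorm x) (x : F) :
    R.liftCLM φ h (R.of x) = φ x :=
  ContinuousLinearMap.fromCompletion_apply_coe (α := R.Pre) _ _

/-- A `⋆`-homomorphism that is contractive for the C⋆-seminorm extends to the enveloping
C⋆-algebra. -/
def lift (φ : F →⋆ₐ[ℂ] D) (h : ∀ x, ‖φ x‖ ≤ R.seminorm x) : R.CStar →⋆ₐ[ℂ] D where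
  toFun := R.liftCLM φ h
  map_one' := by rw [← map_one R.of, liftCLM_of, map_one]
  map_mul' x y := by
    refine R.induction (p := fun x => R.liftCLM φ h (x * y) = R.liftCLM φ h x * R.liftCLM φ h y)
      (isClosed_eq (by fun_prop) (by fun_prop)) (fun x => ?_) x
    refine R.induction (p := fun y => R.liftCLM φ h (R.of x * y) =
      R.liftCLM φ h (R.of x) * R.liftCLM φ h y)
      (isClosed_eq (by fun_prop) (by fun_prop)) (fun y => ?_) y
    change R.liftCLM φ h (R.of x * R.of y) = R.liftCLM φ h (R.of x) * R.liftCLM φ h (R.of y)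
    rw [← map_mul, liftCLM_of, liftCLM_of, liftCLM_of, map_mul]
  map_zero' := map_zero _
  map_add' := map_add _
  commutes' c := by
    rw [Algebra.algebraMap_eq_smul_one, map_smul, ← map_one R.of, liftCLM_of, map_one,
      Algebra.algebraMap_eq_smul_one]
  map_star' x := by
    refine R.induction (p := fun x => R.liftCLM φ h (star x) = star (R.liftCLM φ h x))
      (isClosed_eq ((R.liftCLM φ h).continuous.comp continuous_star)
        (R.liftCLM φ h).continuous.star) (fun x => ?_) x
    change R.liftCLM φ h (star (R.of x)) = star (R.liftCLM φ h (R.of x))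
    rw [← map_star, liftCLM_of, liftCLM_of, map_star]

@[simp]
theorem lift_of (φ : F →⋆ₐ[ℂ] D) (h : ∀ x, ‖φ x‖ ≤ R.seminorm x) (x : F) :
    R.lift φ h (R.of x) = φ x := R.liftCLM_of φ h x

end RepFamily

/-! ### The minimal (spatial) C⋆-tensor product -/

section Hilbert

variable {H K : Type u} [NormedAddCommGroup H] [InnerProductSpace ℂ H] [CompleteSpace H]
  [NormedAddCommGroup K] [InnerProductSpace ℂ K] [CompleteSpace K]

variable (H K) in
/-- The Hilbert space tensor product: the completion of the algebraic tensor product in the norm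
of the inner product `⟪a ⊗ b, c ⊗ d⟫ = ⟪a, c⟫ * ⟪b, d⟫`. -/
def HilbertTensor : Type u := Completion (H ⊗[ℂ] K)

namespace HilbertTensor

instance : NormedAddCommGroup (HilbertTensor H K) :=
  inferInstanceAs (NormedAddCommGroup (Completion (H ⊗[ℂ] K)))
instance : InnerProductSpace ℂ (HilbertTensor H K) :=
  inferInstanceAs (InnerProductSpace ℂ (Completion (H ⊗[ℂ] K)))
instance : CompleteSpace (HilbertTensor H K) :=
  inferInstanceAs (CompleteSpace (Completion (H ⊗[ℂ] K)))

/-- The isometric inclusion of the algebraic tensor product. -/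
def incl : H ⊗[ℂ] K →ₗᵢ[ℂ] HilbertTensor H K :=
  (Completion.toComplₗᵢ : H ⊗[ℂ] K →ₗᵢ[ℂ] Completion (H ⊗[ℂ] K))

theorem denseRange_incl : DenseRange (incl : H ⊗[ℂ] K →ₗᵢ[ℂ] HilbertTensor H K) :=
  Completion.denseRange_coe

theorem induction {p : HilbertTensor H K → Prop} (hp : IsClosed {x | p x})
    (h : ∀ x, p (incl x)) (x) : p x := denseRange_incl.induction_on x hp h

/-- Two bounded operators that agree on elementary tensors are equal. -/
theorem ext_tmul {E : Type*} [NormedAddCommGroup E] [NormedSpace ℂ E]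
    {S T : HilbertTensor H K →L[ℂ] E}
    (h : ∀ (x : H) (y : K), S (incl (x ⊗ₜ y)) = T (incl (x ⊗ₜ y))) : S = T := by
  refine ContinuousLinearMap.ext fun x => ?_
  refine induction (p := fun x => S x = T x) (isClosed_eq S.continuous T.continuous)
    (fun x => ?_) x
  induction x using TensorProduct.induction_on with
  | zero => rw [map_zero, map_zero, map_zero]
  | add x y hx hy => rw [map_add, map_add, map_add, hx, hy]
  | tmul a b => exact h a b

/-- The extension by continuity of a bounded operator. -/
def extend {H' K' : Type u} [NormedAddCommGroup H'] [InnerProductSpace ℂ H']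
    [NormedAddCommGroup K'] [InnerProductSpace ℂ K']
    (T : H ⊗[ℂ] K →L[ℂ] H' ⊗[ℂ] K') : HilbertTensor H K →L[ℂ] HilbertTensor H' K' :=
  T.completion

theorem extend_incl {H' K' : Type u} [NormedAddCommGroup H'] [InnerProductSpace ℂ H']
    [NormedAddCommGroup K'] [InnerProductSpace ℂ K']
    (T : H ⊗[ℂ] K →L[ℂ] H' ⊗[ℂ] K') (x : H ⊗[ℂ] K) : extend T (incl x) = incl (T x) :=
  ContinuousLinearMap.completion_apply_coe _ _

theorem eq_adjoint {S T : HilbertTensor H K →L[ℂ] HilbertTensor H K}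
    (h : ∀ (a c : H) (b d : K), inner ℂ (S (incl (a ⊗ₜ b))) (incl (c ⊗ₜ d)) =
      inner ℂ (incl (a ⊗ₜ b)) (T (incl (c ⊗ₜ d)))) : S = star T := by
  refine ext_tmul fun a b => ?_
  refine ext_inner_right ℂ fun y => ?_
  rw [ContinuousLinearMap.star_eq_adjoint, ContinuousLinearMap.adjoint_inner_left]
  refine induction (p := fun y => inner ℂ (S (incl (a ⊗ₜ b))) y = inner ℂ (incl (a ⊗ₜ b)) (T y))
    (isClosed_eq (by fun_prop) (by fun_prop)) (fun y => ?_) y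
  induction y using TensorProduct.induction_on with
  | zero => rw [map_zero, map_zero, inner_zero_right, inner_zero_right]
  | add x y hx hy => rw [map_add, map_add, inner_add_right, inner_add_right, hx, hy]
  | tmul c d => exact h a c b d

end HilbertTensor

open HilbertTensor

variable (K) in
/-- The bounded operator `T ⊗ 1` on `H ⊗ K`. -/
def ampL (T : H →L[ℂ] H) : HilbertTensor H K →L[ℂ] HilbertTensor H K := extend (T.rTensor K)

variable (H) in
/-- The bounded operator `1 ⊗ T` on `H ⊗ K`. -/
def ampR (T : K →L[ℂ] K) : HilbertTensor H K →L[ℂ] HilbertTensor H K := extend (T.lTensor H)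

theorem ampL_incl (T : H →L[ℂ] H) (x : H) (y : K) :
    ampL K T (incl (x ⊗ₜ y)) = incl (T x ⊗ₜ y) := by
  rw [ampL, extend_incl, ContinuousLinearMap.rTensor_tmul]

theorem ampR_incl (T : K →L[ℂ] K) (x : H) (y : K) :
    ampR H T (incl (x ⊗ₜ y)) = incl (x ⊗ₜ T y) := by
  rw [ampR, extend_incl, ContinuousLinearMap.lTensor_tmul]

variable (K) in
/-- The amplification `T ↦ T ⊗ 1` from `B(H)` to `B(H ⊗ K)`. -/
def ampLeft : (H →L[ℂ] H) →⋆ₐ[ℂ] (HilbertTensor H K →L[ℂ] HilbertTensor H K) where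
  toFun T := ampL K T
  map_one' := ext_tmul fun x y => by rw [ampL_incl]; rfl
  map_mul' S T := ext_tmul fun x y => by
    change _ = ampL K S (ampL K T _)
    rw [ampL_incl, ampL_incl, ampL_incl]; rfl
  map_zero' := ext_tmul fun x y => by
    rw [ampL_incl, zero_apply, TensorProduct.zero_tmul, map_zero]; rfl
  map_add' S T := ext_tmul fun x y => by
    rw [add_apply, ampL_incl, ampL_incl, ampL_incl, add_apply, TensorProduct.add_tmul, map_add]
  commutes' c := ext_tmul fun x y => by
    rw [ampL_incl, Algebra.algebraMap_eq_smul_one, Algebra.algebraMap_eq_smul_one]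
    change incl ((c • x) ⊗ₜ y) = c • incl (x ⊗ₜ y)
    rw [← map_smul, TensorProduct.smul_tmul']
  map_star' T := eq_adjoint fun a c b d => by
    rw [ampL_incl, ampL_incl, LinearIsometry.inner_map_map, LinearIsometry.inner_map_map,
      TensorProduct.inner_tmul, TensorProduct.inner_tmul, ContinuousLinearMap.star_eq_adjoint,
      ContinuousLinearMap.adjoint_inner_left]

variable (H) in
/-- The amplification `T ↦ 1 ⊗ T` from `B(K)` to `B(H ⊗ K)`. -/
def ampRight : (K →L[ℂ] K) →⋆ₐ[ℂ] (HilbertTensor H K →L[ℂ] HilbertTensor H K) where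
  toFun T := ampR H T
  map_one' := ext_tmul fun x y => by rw [ampR_incl]; rfl
  map_mul' S T := ext_tmul fun x y => by
    change _ = ampR H S (ampR H T _)
    rw [ampR_incl, ampR_incl, ampR_incl]; rfl
  map_zero' := ext_tmul fun x y => by
    rw [ampR_incl, zero_apply, TensorProduct.tmul_zero, map_zero]; rfl
  map_add' S T := ext_tmul fun x y => by
    rw [add_apply, ampR_incl, ampR_incl, ampR_incl, add_apply, TensorProduct.tmul_add, map_add]
  commutes' c := ext_tmul fun x y => by
    rw [ampR_incl, Algebra.algebraMap_eq_smul_one, Algebra.algebraMap_eq_smul_one]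
    change incl (x ⊗ₜ (c • y)) = c • incl (x ⊗ₜ y)
    rw [← map_smul, TensorProduct.tmul_smul]
  map_star' T := eq_adjoint fun a c b d => by
    rw [ampR_incl, ampR_incl, LinearIsometry.inner_map_map, LinearIsometry.inner_map_map,
      TensorProduct.inner_tmul, TensorProduct.inner_tmul, ContinuousLinearMap.star_eq_adjoint,
      ContinuousLinearMap.adjoint_inner_left]

theorem ampLeft_incl (T : H →L[ℂ] H) (x : H) (y : K) :
    ampLeft K T (incl (x ⊗ₜ y)) = incl (T x ⊗ₜ y) := ampL_incl T x y

theorem ampRight_incl (T : K →L[ℂ] K) (x : H) (y : K) :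
    ampRight H T (incl (x ⊗ₜ y)) = incl (x ⊗ₜ T y) := ampR_incl T x y

theorem amp_commute (S : H →L[ℂ] H) (T : K →L[ℂ] K) :
    Commute (ampLeft K S) (ampRight H T) := ext_tmul fun x y => by
  change ampLeft K S (ampRight H T _) = ampRight H T (ampLeft K S _)
  rw [ampRight_incl, ampLeft_incl, ampLeft_incl, ampRight_incl]

variable {A B : Type u} [CStarAlgebra A] [CStarAlgebra B]

/-- The `⋆`-homomorphism `a ⊗ b ↦ f a * g b` for `⋆`-homomorphisms with commuting ranges. -/
def starLift {D : Type u} [Ring D] [StarRing D] [Algebra ℂ D] (f : A →⋆ₐ[ℂ] D) (g : B →⋆ₐ[ℂ] D)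
    (h : ∀ a b, Commute (f a) (g b)) : A ⊗[ℂ] B →⋆ₐ[ℂ] D where
  __ := Algebra.TensorProduct.lift f.toAlgHom g.toAlgHom h
  map_star' x := by
    change Algebra.TensorProduct.lift f.toAlgHom g.toAlgHom h (star x) =
      star (Algebra.TensorProduct.lift f.toAlgHom g.toAlgHom h x)
    induction x using TensorProduct.induction_on with
    | zero => simp
    | add x y hx hy => rw [star_add, map_add, map_add, star_add, hx, hy]
    | tmul a b =>
      rw [TensorProduct.star_tmul, Algebra.TensorProduct.lift_tmul,
        Algebra.TensorProduct.lift_tmul]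
      change f (star a) * g (star b) = star (f a * g b)
      rw [star_mul, ← map_star f, ← map_star g]
      exact h (star a) (star b)

theorem starLift_tmul {D : Type u} [Ring D] [StarRing D] [Algebra ℂ D] (f : A →⋆ₐ[ℂ] D)
    (g : B →⋆ₐ[ℂ] D) (h : ∀ a b, Commute (f a) (g b)) (a : A) (b : B) :
    starLift f g h (a ⊗ₜ b) = f a * g b := Algebra.TensorProduct.lift_tmul _ _ h a b

/-- The representation `ρ ⊗ σ` of the algebraic tensor product `A ⊙ B` on `H ⊗ K`. -/
def spatialRep (ρ : A →⋆ₐ[ℂ] (H →L[ℂ] H)) (σ : B →⋆ₐ[ℂ] (K →L[ℂ] K)) :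
    A ⊗[ℂ] B →⋆ₐ[ℂ] (HilbertTensor H K →L[ℂ] HilbertTensor H K) :=
  starLift ((ampLeft K).comp ρ) ((ampRight H).comp σ) fun a b => amp_commute (ρ a) (σ b)

theorem spatialRep_tmul (ρ : A →⋆ₐ[ℂ] (H →L[ℂ] H)) (σ : B →⋆ₐ[ℂ] (K →L[ℂ] K)) (a : A) (b : B) :
    spatialRep ρ σ (a ⊗ₜ b) = ampLeft K (ρ a) * ampRight H (σ b) := by
  exact starLift_tmul _ _ _ a b

theorem spatialRep_tmul_incl (ρ : A →⋆ₐ[ℂ] (H →L[ℂ] H)) (σ : B →⋆ₐ[ℂ] (K →L[ℂ] K)) (a : A)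
    (b : B) (x : H) (y : K) :
    spatialRep ρ σ (a ⊗ₜ b) (incl (x ⊗ₜ y)) = incl (ρ a x ⊗ₜ σ b y) := by
  rw [spatialRep_tmul]
  change ampLeft K (ρ a) (ampRight H (σ b) _) = _
  rw [ampRight_incl, ampLeft_incl]

variable (H K) in
/-- The flip `H ⊗ K → K ⊗ H`. -/
def hilbertFlip : HilbertTensor H K →L[ℂ] HilbertTensor K H :=
  extend (TensorProduct.commIsometry ℂ H K).toContinuousLinearEquiv.toContinuousLinearMap

theorem hilbertFlip_incl (x : H ⊗[ℂ] K) :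
    hilbertFlip H K (incl x) = incl (TensorProduct.comm ℂ H K x) := extend_incl _ _

theorem norm_hilbertFlip (x : HilbertTensor H K) : ‖hilbertFlip H K x‖ = ‖x‖ := by
  refine induction (p := fun x => ‖hilbertFlip H K x‖ = ‖x‖)
    (isClosed_eq (by fun_prop) (by fun_prop)) (fun x => ?_) x
  rw [hilbertFlip_incl, LinearIsometry.norm_map, LinearIsometry.norm_map, TensorProduct.norm_comm]

theorem norm_spatialRep_comm (ρ : A →⋆ₐ[ℂ] (H →L[ℂ] H)) (σ : B →⋆ₐ[ℂ] (K →L[ℂ] K))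
    (z : A ⊗[ℂ] B) :
    ‖spatialRep σ ρ (Algebra.TensorProduct.comm ℂ A B z)‖ ≤ ‖spatialRep ρ σ z‖ := by
  have key : spatialRep σ ρ (Algebra.TensorProduct.comm ℂ A B z) =
      hilbertFlip H K ∘L spatialRep ρ σ z ∘L hilbertFlip K H := by
    refine ext_tmul fun x y => ?_
    change _ = hilbertFlip H K (spatialRep ρ σ z (hilbertFlip K H (incl (x ⊗ₜ y))))
    rw [hilbertFlip_incl, TensorProduct.comm_tmul]
    induction z using TensorProduct.induction_on with
    | zero => simp only [map_zero, zero_apply]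
    | add z z' hz hz' => simp only [map_add, add_apply, hz, hz']
    | tmul a b =>
      rw [Algebra.TensorProduct.comm_tmul, spatialRep_tmul_incl, spatialRep_tmul_incl,
        hilbertFlip_incl, TensorProduct.comm_tmul]
  refine ContinuousLinearMap.opNorm_le_bound (spatialRep σ ρ (Algebra.TensorProduct.comm ℂ A B z))
    (norm_nonneg (spatialRep ρ σ z)) fun x => ?_
  rw [key]
  change ‖hilbertFlip H K (spatialRep ρ σ z (hilbertFlip K H x))‖ ≤ _
  rw [norm_hilbertFlip, ← norm_hilbertFlip x]
  exact ContinuousLinearMap.le_opNorm _ _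

end Hilbert

/-- A pair of representations of `A` and `B` on Hilbert spaces. -/
structure RepPair (A B : Type u) [CStarAlgebra A] [CStarAlgebra B] where
  H : Type u
  K : Type u
  [normH : NormedAddCommGroup H]
  [innerH : InnerProductSpace ℂ H]
  [completeH : CompleteSpace H]
  [normK : NormedAddCommGroup K]
  [innerK : InnerProductSpace ℂ K]
  [completeK : CompleteSpace K]
  ρ : A →⋆ₐ[ℂ] (H →L[ℂ] H)
  σ : B →⋆ₐ[ℂ] (K →L[ℂ] K)

attribute [instance] RepPair.normH RepPair.innerH RepPair.completeH RepPair.normK RepPair.innerK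
  RepPair.completeK

section MinTensor

variable {A B A' B' : Type u} [CStarAlgebra A] [CStarAlgebra B] [CStarAlgebra A'] [CStarAlgebra B']

variable (A B) in
/-- The family of all representations `ρ ⊗ σ` of `A ⊙ B`; its seminorm is the minimal (spatial)
C⋆-norm `‖z‖ = sup ‖(ρ ⊗ σ) z‖`. -/
def spatialFamily : RepFamily.{u, u + 1, u} (A ⊗[ℂ] B) where
  Idx := RepPair A B
  alg i := HilbertTensor i.H i.K →L[ℂ] HilbertTensor i.H i.K
  inst _ := inferInstance
  hom i := spatialRep i.ρ i.σ
  bdd z := by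
    induction z using TensorProduct.induction_on with
    | zero => exact ⟨0, fun i => by simp⟩
    | add x y hx hy =>
      obtain ⟨C, hC⟩ := hx
      obtain ⟨D, hD⟩ := hy
      exact ⟨C + D, fun i => by
        rw [map_add]; exact (norm_add_le _ _).trans (add_le_add (hC i) (hD i))⟩
    | tmul a b =>
      refine ⟨‖a‖ * ‖b‖, fun i => ?_⟩
      rw [spatialRep_tmul]
      refine (norm_mul_le _ _).trans (mul_le_mul ?_ ?_ (norm_nonneg _) (norm_nonneg _))
      · exact NonUnitalStarAlgHom.norm_apply_le ((ampLeft i.K).comp i.ρ) a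
      · exact NonUnitalStarAlgHom.norm_apply_le ((ampRight i.H).comp i.σ) b

variable (A B) in
/-- The minimal C⋆-tensor product of two unital C⋆-algebras. -/
abbrev MinTensor : Type u := (spatialFamily A B).CStar

/-- The elementary tensor `a ⊗ b` in the minimal C⋆-tensor product. -/
def tmul (a : A) (b : B) : MinTensor A B := (spatialFamily A B).of (a ⊗ₜ b)

/-- `f ⊗ g` on the algebraic tensor products. -/
def algMap (f : A →⋆ₐ[ℂ] A') (g : B →⋆ₐ[ℂ] B') : A ⊗[ℂ] B →⋆ₐ[ℂ] A' ⊗[ℂ] B' where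
  __ := Algebra.TensorProduct.map f.toAlgHom g.toAlgHom
  map_star' x := by
    change Algebra.TensorProduct.map f.toAlgHom g.toAlgHom (star x) =
      star (Algebra.TensorProduct.map f.toAlgHom g.toAlgHom x)
    induction x using TensorProduct.induction_on with
    | zero => simp
    | add x y hx hy => rw [star_add, map_add, map_add, star_add, hx, hy]
    | tmul a b => simp [TensorProduct.star_tmul, map_star]

theorem algMap_tmul (f : A →⋆ₐ[ℂ] A') (g : B →⋆ₐ[ℂ] B') (a : A) (b : B) :
    algMap f g (a ⊗ₜ b) = f a ⊗ₜ g b := rfl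

theorem algMap_contractive (f : A →⋆ₐ[ℂ] A') (g : B →⋆ₐ[ℂ] B') (z : A ⊗[ℂ] B) :
    ‖((spatialFamily A' B').of.comp (algMap f g)) z‖ ≤ (spatialFamily A B).seminorm z := by
  change ‖(spatialFamily A' B').of (algMap f g z)‖ ≤ _
  rw [RepFamily.norm_of]
  refine RepFamily.seminorm_le _ (RepFamily.seminorm_nonneg _ _) fun (i : RepPair _ _) => ?_
  have h : spatialRep i.ρ i.σ (algMap f g z) = spatialRep (i.ρ.comp f) (i.σ.comp g) z := by
    induction z using TensorProduct.induction_on with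
    | zero => simp
    | add x y hx hy => simp only [map_add, hx, hy]
    | tmul a b => rw [algMap_tmul, spatialRep_tmul, spatialRep_tmul]; rfl
  change ‖spatialRep i.ρ i.σ (algMap f g z)‖ ≤ _
  rw [h]
  exact (spatialFamily A B).le_seminorm
    { H := i.H, K := i.K, ρ := i.ρ.comp f, σ := i.σ.comp g : RepPair A B } z

/-- The `⋆`-homomorphism `f ⊗ g` between minimal C⋆-tensor products. -/
def map (f : A →⋆ₐ[ℂ] A') (g : B →⋆ₐ[ℂ] B') : MinTensor A B →⋆ₐ[ℂ] MinTensor A' B' :=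
  (spatialFamily A B).lift ((spatialFamily A' B').of.comp (algMap f g)) (algMap_contractive f g)

theorem map_tmul (f : A →⋆ₐ[ℂ] A') (g : B →⋆ₐ[ℂ] B') (a : A) (b : B) :
    map f g (tmul a b) = tmul (f a) (g b) := RepFamily.lift_of _ _ _ _

variable (A B) in
/-- The flip on the algebraic tensor product. -/
def algFlip : A ⊗[ℂ] B →⋆ₐ[ℂ] B ⊗[ℂ] A where
  __ := (Algebra.TensorProduct.comm ℂ A B).toAlgHom
  map_star' x := by
    change Algebra.TensorProduct.comm ℂ A B (star x) = star (Algebra.TensorProduct.comm ℂ A B x)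
    induction x using TensorProduct.induction_on with
    | zero => simp
    | add x y hx hy => rw [star_add, map_add, map_add, star_add, hx, hy]
    | tmul a b => simp [TensorProduct.star_tmul]

theorem algFlip_contractive (z : A ⊗[ℂ] B) :
    ‖((spatialFamily B A).of.comp (algFlip A B)) z‖ ≤ (spatialFamily A B).seminorm z := by
  change ‖(spatialFamily B A).of (Algebra.TensorProduct.comm ℂ A B z)‖ ≤ _
  rw [RepFamily.norm_of]
  refine RepFamily.seminorm_le _ (RepFamily.seminorm_nonneg _ _) fun (i : RepPair _ _) => ?_
  exact (norm_spatialRep_comm i.σ i.ρ z).trans ((spatialFamily A B).le_seminorm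
    { H := i.K, K := i.H, ρ := i.σ, σ := i.ρ : RepPair A B } z)

variable (A B) in
/-- The flip `σ(a ⊗ b) = b ⊗ a` on the minimal C⋆-tensor product. -/
def flip : MinTensor A B →⋆ₐ[ℂ] MinTensor B A :=
  (spatialFamily A B).lift ((spatialFamily B A).of.comp (algFlip A B)) algFlip_contractive

theorem flip_tmul (a : A) (b : B) : flip A B (tmul a b) = tmul b a :=
  RepFamily.lift_of _ _ _ _

end MinTensor

/-! ### Compact quantum groups -/

section CompactQuantumGroup

variable {A B : Type u} [CStarAlgebra A] [CStarAlgebra B]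

/-- A unitary matrix `v` over `A` is a (finite dimensional) unitary representation with respect to
`Δ : A → A ⊗ A` if `Δ(v_ij) = ∑_k v_ik ⊗ v_kj`. -/
structure IsUnitaryRep (Δ : A →⋆ₐ[ℂ] MinTensor A A) {d : ℕ} (v : Matrix (Fin d) (Fin d) A) :
    Prop where
  star_mul_self : vᴴ * v = 1
  mul_star_self : v * vᴴ = 1
  comul_apply : ∀ i j, Δ (v i j) = ∑ k, tmul (v i k) (v k j)

/-- The unital `⋆`-algebra generated by the coefficients of a family of matrices over `A`. -/
def coeffAlg (S : Set (Σ d : ℕ, Matrix (Fin d) (Fin d) A)) : StarSubalgebra ℂ A :=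
  StarAlgebra.adjoin ℂ {a | ∃ p ∈ S, ∃ i j, a = p.2 i j}

/-- A compact quantum group `G`, given by a full Woronowicz C⋆-algebra `A = C(G)`: a nonzero unital
C⋆-algebra with a comultiplication `Δ : A → A ⊗ A` for which some family of finite dimensional
unitary representations with invertible conjugates has coefficients generating a dense
`⋆`-subalgebra (the Hopf `⋆`-algebra of representative functions), such that the norm of `A` is the
universal C⋆-norm on that `⋆`-subalgebra (`A` is full).

Coassociativity of `Δ` is a consequence, since `Δ(v_ij) = ∑_k v_ik ⊗ v_kj` on generators. -/
structure CompactQuantumGroup (A : Type u) [CStarAlgebra A] where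
  comul : A →⋆ₐ[ℂ] MinTensor A A
  nontrivial : Nontrivial A
  exists_family : ∃ S : Set (Σ d : ℕ, Matrix (Fin d) (Fin d) A),
    (∀ p ∈ S, IsUnitaryRep comul p.2 ∧ IsUnit (p.2.map star)) ∧
    Dense (coeffAlg S : Set A) ∧
    ∀ (D : Type u) [CStarAlgebra D] (φ : coeffAlg S →⋆ₐ[ℂ] D) (x : coeffAlg S),
      ‖φ x‖ ≤ ‖(x : A)‖

/-- A matrix over `A` is irreducible if only the scalar matrices intertwine it with itself. -/
def IsIrreducible {d : ℕ} (v : Matrix (Fin d) (Fin d) A) : Prop :=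
  0 < d ∧ ∀ T : Matrix (Fin d) (Fin d) ℂ,
    T.map (algebraMap ℂ A) * v = v * T.map (algebraMap ℂ A) → ∃ c : ℂ, T = c • 1

namespace CompactQuantumGroup

variable (G : CompactQuantumGroup A) (N : CompactQuantumGroup B) (π : A →⋆ₐ[ℂ] B)

/-- `G` is connected if the C⋆-algebra generated by the coefficients of any nontrivial irreducible
(unitary) representation is infinite dimensional. -/
def IsConnected : Prop :=
  ∀ (d : ℕ) (v : Matrix (Fin d) (Fin d) A), IsUnitaryRep G.comul v → IsIrreducible v → v ≠ 1 →
    ¬ FiniteDimensional ℂ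
      (StarAlgebra.adjoin ℂ {a | ∃ i j, a = v i j} : StarSubalgebra ℂ A).topologicalClosure

/-- `A = C(G)` is finitely generated as a Woronowicz C⋆-algebra: the coefficients of some finite
dimensional unitary representation generate it as a C⋆-algebra. -/
def IsFinitelyGenerated : Prop :=
  ∃ (d : ℕ) (v : Matrix (Fin d) (Fin d) A), IsUnitaryRep G.comul v ∧
    Dense (StarAlgebra.adjoin ℂ {a | ∃ i j, a = v i j} : Set A)

/-- `(N, π)` is a quantum subgroup of `G`. -/
structure IsQuantumSubgroup : Prop where
  surjective : Function.Surjective π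
  map_comul : ∀ a, map π π (G.comul a) = N.comul (π a)

/-- `C(G/N) = {a | (id ⊗ π) Δ(a) = a ⊗ 1}`. -/
def rightQuotient : Set A := {a | map (StarAlgHom.id ℂ A) π (G.comul a) = tmul a 1}

/-- `C(N\G) = {a | (π ⊗ id) Δ(a) = 1 ⊗ a}`. -/
def leftQuotient : Set A := {a | map π (StarAlgHom.id ℂ A) (G.comul a) = tmul 1 a}

/-- The quantum subgroup given by `π` is normal if `C(G/N) = C(N\G)`. -/
def IsNormal : Prop := G.rightQuotient π = G.leftQuotient π

/-- The quantum subgroup given by `π` is in the center of `G` if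
`(π ⊗ id) Δ = (π ⊗ id) σ Δ`, where `σ` is the flip. -/
def IsCentral : Prop :=
  ∀ a, map π (StarAlgHom.id ℂ A) (G.comul a) =
    map π (StarAlgHom.id ℂ A) (flip A A (G.comul a))

/-- `G` is simple: (1) `C(G)` is finitely generated, (2) `G` is connected, (3) every connected
normal quantum subgroup `(N, π)` of `G` is the identity group (`C(N) = ℂ`) or the full quantum
group (`π` is an isomorphism), (4) every one dimensional representation of `G` is trivial. -/
structure IsSimple (G : CompactQuantumGroup A) : Prop where
  finitelyGenerated : G.IsFinitelyGenerated
  connected : G.IsConnected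
  normal_trivial : ∀ (C : Type u) [CStarAlgebra C] (N : CompactQuantumGroup C) (π : A →⋆ₐ[ℂ] C),
    IsQuantumSubgroup G N π → G.IsNormal π → N.IsConnected →
      (∀ c : C, ∃ z : ℂ, c = algebraMap ℂ C z) ∨ Function.Injective π
  one_dim_trivial : ∀ v : Matrix (Fin 1) (Fin 1) A, IsUnitaryRep G.comul v → v = 1

end CompactQuantumGroup

end CompactQuantumGroup

/-! ### The universal quantum groups `A_u(Q)` -/

/-- The free unital complex `⋆`-algebra on `X`, realised as the free algebra on the real and
imaginary parts (which are self-adjoint) of the generators. -/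
def FreeStarAlg (X : Type) : Type := ℂ ⊗[ℝ] FreeAlgebra ℝ (X × Bool)

namespace FreeStarAlg

instance (Y : Type) : StarModule ℝ (FreeAlgebra ℝ Y) where
  star_smul r x := by
    rw [Algebra.smul_def, star_mul, FreeAlgebra.star_algebraMap, Algebra.smul_def, star_trivial r]
    exact (Algebra.commutes r (star x)).symm

variable {X : Type}

instance : Ring (FreeStarAlg X) := inferInstanceAs (Ring (ℂ ⊗[ℝ] FreeAlgebra ℝ (X × Bool)))
instance : StarRing (FreeStarAlg X) :=
  inferInstanceAs (StarRing (ℂ ⊗[ℝ] FreeAlgebra ℝ (X × Bool)))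
instance : Algebra ℂ (FreeStarAlg X) :=
  inferInstanceAs (Algebra ℂ (ℂ ⊗[ℝ] FreeAlgebra ℝ (X × Bool)))

/-- The elementary tensor `c ⊗ a`. -/
def mk (c : ℂ) (a : FreeAlgebra ℝ (X × Bool)) : FreeStarAlg X := c ⊗ₜ[ℝ] a

theorem smul_mk (c d : ℂ) (a : FreeAlgebra ℝ (X × Bool)) : c • mk d a = mk (c * d) a := rfl

theorem star_mk (c : ℂ) (a : FreeAlgebra ℝ (X × Bool)) : star (mk c a) = mk (star c) (star a) :=
  rfl

theorem mk_mul_mk (c d : ℂ) (a b : FreeAlgebra ℝ (X × Bool)) :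
    mk c a * mk d b = mk (c * d) (a * b) := Algebra.TensorProduct.tmul_mul_tmul _ _ _ _

theorem induction {p : FreeStarAlg X → Prop} (h₀ : p 0) (h₁ : ∀ c a, p (mk c a))
    (h₂ : ∀ x y, p x → p y → p (x + y)) (x) : p x :=
  TensorProduct.induction_on (motive := p) x h₀ h₁ h₂

instance : StarModule ℂ (FreeStarAlg X) where
  star_smul c x := by
    refine induction (p := fun x => star (c • x) = star c • star x) (by simp) (fun d a => ?_)
      (fun x y hx hy => ?_) x
    · rw [smul_mk, star_mk, star_mk, smul_mk, star_mul, mul_comm]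
    · rw [smul_add, star_add, star_add, smul_add, hx, hy]

/-- The self-adjoint generators: real parts (`b = false`) and imaginary parts (`b = true`). -/
def part (x : X) (b : Bool) : FreeStarAlg X := mk 1 (FreeAlgebra.ι ℝ (x, b))

/-- The free generators. -/
def gen (x : X) : FreeStarAlg X := part x false + Complex.I • part x true

theorem star_part (x : X) (b : Bool) : star (part x b) = part x b := by
  rw [part, star_mk, star_one, FreeAlgebra.star_ι]

/-- A subalgebra containing all parts of the generators is everything. -/
theorem subalgebra_eq_top (S : Subalgebra ℂ (FreeStarAlg X)) (h : ∀ x b, part x b ∈ S) (x) :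
    x ∈ S := by
  have key (a : FreeAlgebra ℝ (X × Bool)) : mk 1 a ∈ S := by
    induction a using FreeAlgebra.induction with
    | grade0 r =>
      have : mk 1 (algebraMap ℝ (FreeAlgebra ℝ (X × Bool)) r) =
          algebraMap ℂ (FreeStarAlg X) (r : ℂ) := by
        rw [Algebra.algebraMap_eq_smul_one, Algebra.algebraMap_eq_smul_one]
        exact (TensorProduct.tmul_smul r (1 : ℂ) (1 : FreeAlgebra ℝ (X × Bool))).trans rfl
      rw [this]
      exact S.algebraMap_mem _
    | grade1 p => exact h p.1 p.2
    | mul a b ha hb =>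
      have := S.mul_mem ha hb
      rwa [mk_mul_mk, one_mul] at this
    | add a b ha hb =>
      have := S.add_mem ha hb
      rwa [show mk (1 : ℂ) a + mk 1 b = mk 1 (a + b) from (TensorProduct.tmul_add _ _ _).symm]
        at this
  refine induction (p := fun x => x ∈ S) S.zero_mem (fun c a => ?_)
    (fun x y => S.add_mem) x
  have := S.smul_mem (key a) c
  rwa [smul_mk, mul_one] at this

theorem part_false (x : X) : part x false = (2⁻¹ : ℂ) • (gen x + star (gen x)) := by
  rw [gen, star_add, star_smul, star_part, star_part]
  simp only [Complex.star_def, Complex.conj_I]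
  module

theorem part_true (x : X) : part x true = (-(2⁻¹ * Complex.I) : ℂ) • (gen x - star (gen x)) := by
  rw [gen, star_add, star_smul, star_part, star_part]
  simp only [Complex.star_def, Complex.conj_I]
  have : Complex.I * Complex.I = -1 := Complex.I_mul_I
  match_scalars
  · linear_combination this
  · ring

variable {B : Type*} [CStarAlgebra B]

/-- The underlying algebra homomorphism of `FreeStarAlg.lift`. -/
def liftAlgHom (f : X → B) : FreeStarAlg X →ₐ[ℂ] B :=
  AlgHom.liftEquiv ℝ ℂ (FreeAlgebra ℝ (X × Bool)) B (FreeAlgebra.lift ℝ fun p =>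
    if p.2 then (imaginaryPart (f p.1) : B) else (realPart (f p.1) : B))

theorem liftAlgHom_mk (f : X → B) (c : ℂ) (a : FreeAlgebra ℝ (X × Bool)) :
    liftAlgHom f (mk c a) = c • FreeAlgebra.lift ℝ (fun p : X × Bool =>
      if p.2 then (imaginaryPart (f p.1) : B) else (realPart (f p.1) : B)) a := rfl

/-- The universal property of the free `⋆`-algebra. -/
def lift (f : X → B) : FreeStarAlg X →⋆ₐ[ℂ] B where
  __ := liftAlgHom f
  map_star' x := by
    change liftAlgHom f (star x) = star (liftAlgHom f x)
    refine induction (p := fun x => liftAlgHom f (star x) = star (liftAlgHom f x)) (by simp)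
      (fun c a => ?_) (fun x y hx hy => ?_) x
    · rw [star_mk, liftAlgHom_mk, liftAlgHom_mk, star_smul]
      congr 1
      induction a using FreeAlgebra.induction with
      | grade0 r =>
        rw [FreeAlgebra.star_algebraMap, AlgHom.commutes, IsScalarTower.algebraMap_apply ℝ ℂ B,
          Algebra.algebraMap_eq_smul_one, star_smul, star_one]
        simp
      | grade1 p => rw [FreeAlgebra.star_ι, FreeAlgebra.lift_ι_apply]; split <;> simp
      | mul a b ha hb => rw [star_mul, map_mul, map_mul, star_mul, ha, hb]
      | add a b ha hb => rw [star_add, map_add, map_add, star_add, ha, hb]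
    · rw [star_add, map_add, map_add, star_add, hx, hy]

theorem lift_gen (f : X → B) (x : X) : lift f (gen x) = f x := by
  change liftAlgHom f (gen x) = f x
  rw [gen, map_add, map_smul, part, part, liftAlgHom_mk, liftAlgHom_mk,
    FreeAlgebra.lift_ι_apply, FreeAlgebra.lift_ι_apply]
  simpa using realPart_add_I_smul_imaginaryPart (f x)

end FreeStarAlg

/-- The defining relations of `A_u(Q)`:
`v⋆ v = 1 = v v⋆` and `vᵗ Q v̄ Q⁻¹ = 1 = Q v̄ Q⁻¹ vᵗ`, where `v̄ = (v_ij⋆)`. -/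
structure IsAuMatrix {n : ℕ} (Q : GL (Fin n) ℂ) {B : Type*} [Ring B] [StarRing B] [Algebra ℂ B]
    (v : Matrix (Fin n) (Fin n) B) : Prop where
  star_mul_self : vᴴ * v = 1
  mul_star_self : v * vᴴ = 1
  transpose_mul : vᵀ * (Q : Matrix (Fin n) (Fin n) ℂ).map (algebraMap ℂ B) * v.map star *
    ((Q⁻¹ : GL (Fin n) ℂ) : Matrix (Fin n) (Fin n) ℂ).map (algebraMap ℂ B) = 1
  mul_transpose : (Q : Matrix (Fin n) (Fin n) ℂ).map (algebraMap ℂ B) * v.map star *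
    ((Q⁻¹ : GL (Fin n) ℂ) : Matrix (Fin n) (Fin n) ℂ).map (algebraMap ℂ B) * vᵀ = 1

theorem IsAuMatrix.congr {n : ℕ} {Q : GL (Fin n) ℂ} {F B : Type*} [Ring F] [StarRing F]
    [Algebra ℂ F] [Ring B] [StarRing B] [Algebra ℂ B] (f : F →⋆ₐ[ℂ] B)
    (v : Matrix (Fin n) (Fin n) F) :
    IsAuMatrix Q (v.map f) ↔
      (vᴴ * v).map f = 1 ∧ (v * vᴴ).map f = 1 ∧
      (vᵀ * (Q : Matrix (Fin n) (Fin n) ℂ).map (algebraMap ℂ F) * v.map star *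
        ((Q⁻¹ : GL (Fin n) ℂ) : Matrix (Fin n) (Fin n) ℂ).map (algebraMap ℂ F)).map f = 1 ∧
      ((Q : Matrix (Fin n) (Fin n) ℂ).map (algebraMap ℂ F) * v.map star *
        ((Q⁻¹ : GL (Fin n) ℂ) : Matrix (Fin n) (Fin n) ℂ).map (algebraMap ℂ F) * vᵀ).map f = 1 := by
  have h1 : vᴴ.map f = (v.map f)ᴴ := by ext i j; simp [map_star]
  have h2 : vᵀ.map f = (v.map f)ᵀ := rfl
  have h3 : (v.map star).map f = (v.map f).map star := by ext i j; simp [map_star]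
  have h4 (M : Matrix (Fin n) (Fin n) ℂ) :
      (M.map (algebraMap ℂ F)).map f = M.map (algebraMap ℂ B) := by
    ext i j; simp [Algebra.algebraMap_eq_smul_one]
  have h5 (M N : Matrix (Fin n) (Fin n) F) : (M * N).map f = M.map f * N.map f := by
    ext i j; simp [Matrix.mul_apply]
  simp only [h5, h1, h2, h3, h4]
  exact ⟨fun h => ⟨h.1, h.2, h.3, h.4⟩, fun ⟨a, b, c, d⟩ => ⟨a, b, c, d⟩⟩

theorem norm_entry_le_one {n : ℕ} {B : Type*} [CStarAlgebra B] {v : Matrix (Fin n) (Fin n) B}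
    (h : vᴴ * v = 1) (i j : Fin n) : ‖v i j‖ ≤ 1 := by
  let _ := CStarAlgebra.spectralOrder B
  have _ := CStarAlgebra.spectralOrderedRing B
  have h1 : ∑ k, star (v k j) * v k j = 1 := by
    have := congrFun (congrFun h j) j
    simpa [Matrix.mul_apply] using this
  have h2 : star (v i j) * v i j ≤ 1 := by
    rw [← h1]
    exact Finset.single_le_sum (f := fun k => star (v k j) * v k j)
      (fun k _ => star_mul_self_nonneg _) (Finset.mem_univ i)
  have h3 : ‖v i j‖ * ‖v i j‖ ≤ 1 := by
    rw [← CStarRing.norm_star_mul_self]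
    refine (CStarAlgebra.norm_le_norm_of_nonneg_of_le (star_mul_self_nonneg _) h2).trans ?_
    have : ‖(1 : B)‖ * ‖(1 : B)‖ = ‖(1 : B)‖ := by
      rw [← CStarRing.norm_star_mul_self, star_one, one_mul]
    nlinarith [norm_nonneg (1 : B)]
  nlinarith [norm_nonneg (v i j)]

/-- A representation of the relations of `A_u(Q)` in a C⋆-algebra. -/
structure AuRep {n : ℕ} (Q : GL (Fin n) ℂ) where
  B : Type
  [inst : CStarAlgebra B]
  hom : FreeStarAlg (Fin n × Fin n) →⋆ₐ[ℂ] B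
  rel : IsAuMatrix Q (Matrix.of fun i j => hom (FreeStarAlg.gen (i, j)))

attribute [instance] AuRep.inst

/-- The family of all representations of the relations of `A_u(Q)` in C⋆-algebras. -/
def auFamily {n : ℕ} (Q : GL (Fin n) ℂ) :
    RepFamily.{0, 1, 0} (FreeStarAlg (Fin n × Fin n)) where
  Idx := AuRep Q
  alg i := i.B
  inst _ := inferInstance
  hom i := i.hom
  bdd x := by
    let S : Subalgebra ℂ (FreeStarAlg (Fin n × Fin n)) :=
      { carrier := {x | ∃ C : ℝ, ∀ i : AuRep Q, ‖i.hom x‖ ≤ C}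
        mul_mem' := by
          rintro x y ⟨C, hC⟩ ⟨D, hD⟩
          refine ⟨|C| * |D|, fun i => ?_⟩
          rw [map_mul]
          exact (norm_mul_le _ _).trans (mul_le_mul ((hC i).trans (le_abs_self _))
            ((hD i).trans (le_abs_self _)) (norm_nonneg _) (abs_nonneg _))
        add_mem' := by
          rintro x y ⟨C, hC⟩ ⟨D, hD⟩
          refine ⟨C + D, fun i => ?_⟩
          rw [map_add]
          exact (norm_add_le _ _).trans (add_le_add (hC i) (hD i))
        algebraMap_mem' := fun c => by
          refine ⟨‖c‖ * 1, fun i => ?_⟩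
          rw [Algebra.algebraMap_eq_smul_one, map_smul, map_one, norm_smul]
          refine mul_le_mul_of_nonneg_left ?_ (norm_nonneg _)
          have : ‖(1 : i.B)‖ * ‖(1 : i.B)‖ = ‖(1 : i.B)‖ := by
            rw [← CStarRing.norm_star_mul_self, star_one, one_mul]
          nlinarith [norm_nonneg (1 : i.B)] }
    have hgen (p : Fin n × Fin n) (i : AuRep Q) : ‖i.hom (FreeStarAlg.gen p)‖ ≤ 1 :=
      norm_entry_le_one i.rel.star_mul_self p.1 p.2
    have hmem (p : Fin n × Fin n) : FreeStarAlg.gen p ∈ S := ⟨1, hgen p⟩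
    have hmem' (p : Fin n × Fin n) : star (FreeStarAlg.gen p) ∈ S :=
      ⟨1, fun i => by rw [map_star, norm_star]; exact hgen p i⟩
    refine FreeStarAlg.subalgebra_eq_top S (fun p b => ?_) x
    cases b
    · rw [FreeStarAlg.part_false]
      exact S.smul_mem (S.add_mem (hmem p) (hmem' p)) _
    · rw [FreeStarAlg.part_true]
      exact S.smul_mem (S.sub_mem (hmem p) (hmem' p)) _

/-- The universal C⋆-algebra `A_u(Q)` with generators `u_ij` and the relations `IsAuMatrix Q u`. -/
abbrev Au {n : ℕ} (Q : GL (Fin n) ℂ) : Type := (auFamily Q).CStar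

/-- The matrix `u` of canonical generators of `A_u(Q)`. -/
def Au.u {n : ℕ} (Q : GL (Fin n) ℂ) : Matrix (Fin n) (Fin n) (Au Q) :=
  Matrix.of fun i j => (auFamily Q).of (FreeStarAlg.gen (i, j))

/-- The generators of `A_u(Q)` satisfy the defining relations. -/
theorem Au.isAuMatrix_u {n : ℕ} (Q : GL (Fin n) ℂ) : IsAuMatrix Q (Au.u Q) := by
  have key (M : Matrix (Fin n) (Fin n) (FreeStarAlg (Fin n × Fin n)))
      (h : ∀ i : AuRep Q, M.map i.hom = 1) : M.map (auFamily Q).of = 1 := by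
    ext a b
    have h0 : (auFamily Q).seminorm (M a b - (1 : Matrix (Fin n) (Fin n) _) a b) ≤ 0 :=
      (auFamily Q).seminorm_le le_rfl fun (i : AuRep Q) => by
        have := congrFun (congrFun (h i) a) b
        change ‖i.hom (M a b - _)‖ ≤ 0
        rw [map_sub, show i.hom (M a b) = _ from this]
        by_cases hab : a = b <;> simp [Matrix.one_apply, hab]
    rw [← RepFamily.norm_of, norm_le_zero_iff, map_sub, sub_eq_zero] at h0
    rw [Matrix.map_apply, h0]
    by_cases hab : a = b <;> simp [Matrix.one_apply, hab]
  have hrel (i : AuRep Q) := (IsAuMatrix.congr (Q := Q) i.hom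
    (Matrix.of fun a b => FreeStarAlg.gen (a, b))).1 i.rel
  exact (IsAuMatrix.congr (auFamily Q).of (Matrix.of fun a b => FreeStarAlg.gen (a, b))).2
    ⟨key _ fun i => (hrel i).1, key _ fun i => (hrel i).2.1, key _ fun i => (hrel i).2.2.1,
      key _ fun i => (hrel i).2.2.2⟩

/-- The universal property of `A_u(Q)`: existence. -/
theorem Au.exists_lift {n : ℕ} (Q : GL (Fin n) ℂ) {B : Type} [CStarAlgebra B]
    (v : Matrix (Fin n) (Fin n) B) (hv : IsAuMatrix Q v) :
    ∃ φ : Au Q →⋆ₐ[ℂ] B, ∀ i j, φ (Au.u Q i j) = v i j := by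
  have hgen (i j : Fin n) : FreeStarAlg.lift (fun p : Fin n × Fin n => v p.1 p.2)
      (FreeStarAlg.gen (i, j)) = v i j := FreeStarAlg.lift_gen _ _
  let r : AuRep Q :=
    { B := B
      hom := FreeStarAlg.lift fun p => v p.1 p.2
      rel := by
        convert hv using 1
        ext i j
        exact hgen i j }
  exact ⟨(auFamily Q).lift r.hom fun x => (auFamily Q).le_seminorm r x, fun i j =>
    ((auFamily Q).lift_of _ _ _).trans (hgen i j)⟩

/-- The generators generate `A_u(Q)` as a C⋆-algebra. -/
theorem Au.dense_adjoin {n : ℕ} (Q : GL (Fin n) ℂ) :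
    Dense (StarAlgebra.adjoin ℂ {a | ∃ i j, a = Au.u Q i j} : Set (Au Q)) := by
  refine Dense.mono ?_ (auFamily Q).denseRange_of
  rintro _ ⟨x, rfl⟩
  let S := StarAlgebra.adjoin ℂ {a | ∃ i j, a = Au.u Q i j}
  have hmem (p : Fin n × Fin n) : (auFamily Q).of (FreeStarAlg.gen p) ∈ S :=
    StarAlgebra.subset_adjoin ℂ _ ⟨p.1, p.2, rfl⟩
  refine FreeStarAlg.subalgebra_eq_top (S.toSubalgebra.comap (auFamily Q).of.toAlgHom)
    (fun p b => ?_) x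
  change (auFamily Q).of (FreeStarAlg.part p b) ∈ S
  cases b
  · rw [FreeStarAlg.part_false, map_smul, map_add, map_star]
    exact S.smul_mem (S.add_mem (hmem p) (star_mem (s := S) (hmem p))) _
  · rw [FreeStarAlg.part_true, map_smul, map_sub, map_star]
    exact S.smul_mem (S.sub_mem (hmem p) (star_mem (s := S) (hmem p))) _

/-- The coordinate function `t` of the circle group. -/
def circleCoord : C(Circle, ℂ) := ⟨fun z => (z : ℂ), by fun_prop⟩

end QuantumGroup

/-!
The universal property of `A_u(Q)` provides every homomorphism that is needed. If `v` and `w` satisfy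
the relations of `A_u(Q)` and their entries commute with each other, then `v * w` satisfies them too
(`IsAuMatrix.mul`); applied to the two copies of `u` in `A_u(Q) ⊗ A_u(Q)` this gives the
comultiplication. The relations hold already in the `⋆`-algebra generated by the coefficients of `u`,
so each homomorphism from it to a C⋆-algebra extends to `A_u(Q)`, which is therefore full. The scalar
matrix with diagonal entry `t` satisfies the relations as well, and this gives
`π : A_u(Q) → C(𝕋)`. It is surjective because its range is dense (Stone–Weierstrass) and ranges of
homomorphisms of C⋆-algebras are closed (`surjective_of_denseRange`).

The circle is treated in the same way: by continuous functional calculus `C(𝕋)` is the universal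
C⋆-algebra generated by a unitary (`exists_circleLift`). It is connected because a function that lies
in a finite dimensional subalgebra of `C(𝕋)` takes finitely many values, hence is constant, and a
representation with constant coefficients is trivial.

Both `(π ⊗ id) Δ` and `(π ⊗ id) σ Δ` send `u_ij` to `t ⊗ u_ij`, so the circle is central, and central
quantum subgroups are normal (`CompactQuantumGroup.IsCentral.isNormal`).

If `A_u(Q)` were simple, `π` would therefore be injective, as `C(𝕋) ≠ ℂ`. This is not absurd by
itself: it happens for `n = 1`, and for any `n` when `Q` is such that the relations force `u` to be a
scalar matrix. But then `u_ij = 0` for `i ≠ j`, so that `u_ii` is a one dimensional representation,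
nontrivial since `π(u_ii) = t`. This contradicts the last condition in the definition of simplicity.
-/

namespace QuantumGroup

universe u

open scoped CStarAlgebra

/-! ### Homomorphisms of C⋆-algebras -/

section Hom

variable {A B : Type*} [CStarAlgebra A] [CStarAlgebra B]

theorem starAlgHom_ext_of_dense_adjoin {s : Set A}
    (hs : Dense (StarAlgebra.adjoin ℂ s : Set A)) {f g : A →⋆ₐ[ℂ] B} (h : s.EqOn f g) : f = g :=
  DFunLike.coe_injective <|
    Continuous.ext_on hs (map_continuous f) (map_continuous g)
      fun _ hx => StarAlgHom.adjoin_le_equalizer f g h hx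

/-- A self-adjoint element of the range has a preimage of no larger norm: truncate any self-adjoint
preimage by the functional calculus. -/
theorem exists_preimage_norm_le_of_isSelfAdjoint [Nontrivial B] (φ : A →⋆ₐ[ℂ] B) {a : A}
    (ha : IsSelfAdjoint (φ a)) : ∃ a', φ a' = φ a ∧ ‖a'‖ ≤ ‖φ a‖ := by
  have hsa : IsSelfAdjoint (realPart a : A) := (realPart a).2
  have hφ : φ (realPart a : A) = φ a := by
    rw [realPart_apply_coe, map_real_smul φ (map_continuous φ), map_add, map_star,
      ha.star_eq, ← two_smul ℝ, smul_smul]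
    norm_num
  set r : ℝ := ‖φ a‖
  have hr : 0 ≤ r := norm_nonneg _
  have hcont : Continuous fun x : ℝ => max (-r) (min r x) := by fun_prop
  refine ⟨cfc (fun x : ℝ => max (-r) (min r x)) (realPart a : A), ?_, ?_⟩
  · rw [StarAlgHomClass.map_cfc φ _ _ hcont.continuousOn (map_continuous φ) hsa (hsa.map φ), hφ]
    conv_rhs => rw [← cfc_id ℝ (φ a) ha]
    refine cfc_congr fun x hx => ?_
    have hx' : ‖x‖ ≤ r := spectrum.norm_le_norm_of_mem hx
    rw [Real.norm_eq_abs, abs_le] at hx'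
    simp [hx'.1, hx'.2]
  · refine norm_cfc_le hr fun x _ => ?_
    rw [Real.norm_eq_abs, abs_le]
    exact ⟨le_max_left _ _, max_le (by linarith) (min_le_left _ _)⟩

/-- The range of a homomorphism of C⋆-algebras is closed: elements of the range have preimages of
comparable norm, so that the range of `φ` is complete. -/
theorem surjective_of_denseRange [Nontrivial B] (φ : A →⋆ₐ[ℂ] B) (h : DenseRange φ) :
    Function.Surjective φ := by
  let f : NormedAddGroupHom A B := (φ : A →+ B).mkNormedAddGroupHom 1
    fun x => by rw [one_mul]; exact NonUnitalStarAlgHom.norm_apply_le φ x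
  -- Real and imaginary parts each contribute a preimage of norm at most `‖φ a‖`.
  have hf : f.SurjectiveOnWith f.range 2 := by
    rintro _ ⟨a, rfl⟩
    change ∃ g, φ g = φ a ∧ ‖g‖ ≤ 2 * ‖φ a‖
    have hre : φ (realPart a : A) = realPart (φ a) := by
      rw [realPart_apply_coe, realPart_apply_coe, map_real_smul φ (map_continuous φ), map_add,
        map_star]
    have him : φ (imaginaryPart a : A) = imaginaryPart (φ a) := by
      rw [imaginaryPart_apply_coe, imaginaryPart_apply_coe, map_smul,
        map_real_smul φ (map_continuous φ), map_sub, map_star]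
    obtain ⟨x, hx, hx'⟩ := exists_preimage_norm_le_of_isSelfAdjoint φ
      (a := (realPart a : A)) ((realPart a).2.map φ)
    obtain ⟨y, hy, hy'⟩ := exists_preimage_norm_le_of_isSelfAdjoint φ
      (a := (imaginaryPart a : A)) ((imaginaryPart a).2.map φ)
    rw [hre] at hx hx'
    rw [him] at hy hy'
    refine ⟨x + Complex.I • y, ?_, ?_⟩
    · rw [map_add, map_smul, hx, hy, realPart_add_I_smul_imaginaryPart]
    · have h1 := realPart.norm_le (φ a)
      have h2 := imaginaryPart.norm_le (φ a)
      refine (norm_add_le _ _).trans ?_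
      rw [norm_smul, Complex.norm_I, one_mul]
      change ‖(realPart (φ a) : B)‖ ≤ _ at h1
      change ‖(imaginaryPart (φ a) : B)‖ ≤ _ at h2
      linarith
  intro b
  have hb : b ∈ f.range.topologicalClosure := by
    change b ∈ closure (Set.range φ)
    rw [h.closure_range]
    trivial
  obtain ⟨a, ha, -⟩ := controlled_closure_of_complete two_pos one_pos hf b hb
  exact ⟨a, ha⟩

end Hom

/-! ### Minimal tensor products -/

section MinTensor

variable {A B : Type u} [CStarAlgebra A] [CStarAlgebra B]

theorem tmul_mul_tmul (a a' : A) (b b' : B) :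
    tmul a b * tmul a' b' = tmul (a * a') (b * b') := by
  rw [tmul, tmul, ← map_mul, Algebra.TensorProduct.tmul_mul_tmul]; rfl

theorem star_tmul (a : A) (b : B) : star (tmul a b) = tmul (star a) (star b) := by
  rw [tmul, ← map_star, TensorProduct.star_tmul]; rfl

theorem one_tmul_one : tmul (1 : A) (1 : B) = 1 := map_one (spatialFamily A B).of

theorem zero_tmul (b : B) : tmul (0 : A) b = 0 := by
  rw [tmul, TensorProduct.zero_tmul, map_zero]

theorem tmul_zero (a : A) : tmul a (0 : B) = 0 := by
  rw [tmul, TensorProduct.tmul_zero, map_zero]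

theorem smul_tmul_smul (c d : ℂ) (a : A) (b : B) :
    tmul (c • a) (d • b) = (c * d) • tmul a b := by
  rw [tmul, TensorProduct.smul_tmul_smul, map_smul]; rfl

variable (A B) in
/-- The homomorphism `a ↦ a ⊗ 1`. -/
def tmulLeft : A →⋆ₐ[ℂ] MinTensor A B :=
  (spatialFamily A B).of.comp
    { (Algebra.TensorProduct.includeLeft : A →ₐ[ℂ] A ⊗[ℂ] B) with
      map_star' := fun a => by
        change star a ⊗ₜ[ℂ] (1 : B) = star (a ⊗ₜ[ℂ] (1 : B))
        rw [TensorProduct.star_tmul, star_one] }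

variable (A B) in
/-- The homomorphism `b ↦ 1 ⊗ b`. -/
def tmulRight : B →⋆ₐ[ℂ] MinTensor A B :=
  (spatialFamily A B).of.comp
    { (Algebra.TensorProduct.includeRight : B →ₐ[ℂ] A ⊗[ℂ] B) with
      map_star' := fun b => by
        change (1 : A) ⊗ₜ[ℂ] star b = star ((1 : A) ⊗ₜ[ℂ] b)
        rw [TensorProduct.star_tmul, star_one] }

theorem tmulLeft_apply (a : A) : tmulLeft A B a = tmul a 1 := rfl

theorem tmulRight_apply (b : B) : tmulRight A B b = tmul 1 b := rfl

theorem flip_flip (z : MinTensor A B) : flip B A (flip A B z) = z := by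
  refine (spatialFamily A B).induction (p := fun z => flip B A (flip A B z) = z)
    (isClosed_eq ((map_continuous _).comp (map_continuous _)) continuous_id) (fun x => ?_) z
  change flip B A (flip A B ((spatialFamily A B).of x)) = (spatialFamily A B).of x
  induction x using TensorProduct.induction_on with
  | zero => simp
  | add x y hx hy => simp only [map_add, hx, hy]
  | tmul a b =>
    change flip B A (flip A B (tmul a b)) = tmul a b
    rw [flip_tmul, flip_tmul]

theorem flip_map {A' B' : Type u} [CStarAlgebra A'] [CStarAlgebra B'] (f : A →⋆ₐ[ℂ] A')
    (g : B →⋆ₐ[ℂ] B') (z : MinTensor A B) : flip A' B' (map f g z) = map g f (flip A B z) := by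
  refine (spatialFamily A B).induction
    (p := fun z => flip A' B' (map f g z) = map g f (flip A B z))
    (isClosed_eq ((map_continuous _).comp (map_continuous _))
      ((map_continuous _).comp (map_continuous _))) (fun x => ?_) z
  change flip A' B' (map f g ((spatialFamily A B).of x)) =
    map g f (flip A B ((spatialFamily A B).of x))
  induction x using TensorProduct.induction_on with
  | zero => simp
  | add x y hx hy => simp only [map_add, hx, hy]
  | tmul a b =>
    change flip A' B' (map f g (tmul a b)) = map g f (flip A B (tmul a b))
    rw [map_tmul, flip_tmul, flip_tmul, map_tmul]

/-- If `A` and `B` have characters, then so does `A ⊗ B`; in particular it is not zero. -/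
theorem nontrivial_minTensor {A B : Type} [CStarAlgebra A] [CStarAlgebra B] (χ : A →⋆ₐ[ℂ] ℂ)
    (η : B →⋆ₐ[ℂ] ℂ) : Nontrivial (MinTensor A B) := by
  -- The one dimensional representation `χ ⊗ η` of `A ⊙ B` on `ℂ ⊗ ℂ`.
  let i : RepPair A B :=
    { H := ℂ, K := ℂ
      ρ := (StarAlgHom.ofId ℂ (ℂ →L[ℂ] ℂ)).comp χ
      σ := (StarAlgHom.ofId ℂ (ℂ →L[ℂ] ℂ)).comp η }
  -- If `A ⊗ B = 0`, then `1` has seminorm `0`, and it acts as zero on the unit vector `1 ⊗ 1`.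
  by_contra h
  rw [not_nontrivial_iff_subsingleton] at h
  have h1 : ‖spatialRep i.ρ i.σ 1‖ ≤ 0 := by
    refine ((spatialFamily A B).le_seminorm i 1).trans ?_
    rw [← RepFamily.norm_of, Subsingleton.elim ((spatialFamily A B).of 1) 0, norm_zero]
  rw [norm_le_zero_iff, map_one] at h1
  have h2 := congrArg norm
    (DFunLike.congr_fun h1 (HilbertTensor.incl ((1 : ℂ) ⊗ₜ[ℂ] (1 : ℂ))))
  change ‖HilbertTensor.incl ((1 : ℂ) ⊗ₜ[ℂ] (1 : ℂ))‖ = ‖(0 : HilbertTensor ℂ ℂ)‖ at h2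
  rw [LinearIsometry.norm_map, TensorProduct.norm_tmul] at h2
  simp at h2

end MinTensor

/-! ### Compact quantum matrix groups -/

section MatrixGroup

theorem matrix_fin_one_eq_one {R : Type*} [Semiring R] {M : Matrix (Fin 1) (Fin 1) R}
    (h : M 0 0 = 1) : M = 1 := by
  ext1 i j
  rw [Subsingleton.elim i 0, Subsingleton.elim j 0, h, Matrix.one_apply_eq]

variable {A : Type u} [CStarAlgebra A]

theorem coeffAlg_singleton {d : ℕ} (v : Matrix (Fin d) (Fin d) A) :
    coeffAlg {(⟨d, v⟩ : Σ d : ℕ, Matrix (Fin d) (Fin d) A)} =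
      StarAlgebra.adjoin ℂ {a | ∃ i j, a = v i j} := by
  simp [coeffAlg]

theorem mem_coeffAlg_singleton {d : ℕ} (v : Matrix (Fin d) (Fin d) A) (i j : Fin d) :
    v i j ∈ coeffAlg {(⟨d, v⟩ : Σ d : ℕ, Matrix (Fin d) (Fin d) A)} :=
  StarAlgebra.subset_adjoin ℂ _ ⟨_, rfl, i, j, rfl⟩

/-- The compact quantum group with a given fundamental representation `v`. The C⋆-algebra is full as
soon as every homomorphism from the `⋆`-algebra of coefficients into a C⋆-algebra extends to `A`,
since homomorphisms of C⋆-algebras are contractive. -/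
def CompactQuantumGroup.ofMatrix [Nontrivial A] (Δ : A →⋆ₐ[ℂ] MinTensor A A) {d : ℕ}
    (v : Matrix (Fin d) (Fin d) A) (hv : IsUnitaryRep Δ v) (hconj : IsUnit (v.map star))
    (hd : Dense (StarAlgebra.adjoin ℂ {a | ∃ i j, a = v i j} : Set A))
    (hext : ∀ (D : Type u) [CStarAlgebra D]
      (φ : coeffAlg {(⟨d, v⟩ : Σ d : ℕ, Matrix (Fin d) (Fin d) A)} →⋆ₐ[ℂ] D),
      ∃ ψ : A →⋆ₐ[ℂ] D, ∀ i j, ψ (v i j) = φ ⟨v i j, mem_coeffAlg_singleton v i j⟩) :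
    CompactQuantumGroup A where
  comul := Δ
  nontrivial := inferInstance
  exists_family := by
    refine ⟨{⟨d, v⟩}, ?_, by rwa [coeffAlg_singleton], fun D _ φ x => ?_⟩
    · rintro p rfl
      exact ⟨hv, hconj⟩
    · obtain ⟨ψ, hψ⟩ := hext D φ
      have h : φ = ψ.comp (coeffAlg _).subtype := by
        refine StarAlgHom.ext_adjoin ?_
        rintro ⟨_, _⟩ ⟨p, hp, i, j, rfl⟩
        obtain rfl := hp
        exact (hψ i j).symm
      rw [h]
      exact NonUnitalStarAlgHom.norm_apply_le ψ (x : A)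

end MatrixGroup

/-! ### The comultiplication of `A_u(Q)` -/

section Au

variable {n : ℕ} {Q : GL (Fin n) ℂ}

theorem map_eq_one {m : Type*} [DecidableEq m] {F B : Type*} [Ring F] [StarRing F] [Algebra ℂ F]
    [Ring B] [StarRing B] [Algebra ℂ B] (f : F →⋆ₐ[ℂ] B) {M : Matrix m m F} (h : M = 1) :
    M.map f = 1 := by
  rw [h, Matrix.map_one f (map_zero f) (map_one f)]

theorem IsAuMatrix.map {F B : Type*} [Ring F] [StarRing F] [Algebra ℂ F] [Ring B] [StarRing B]
    [Algebra ℂ B] (f : F →⋆ₐ[ℂ] B) {v : Matrix (Fin n) (Fin n) F} (h : IsAuMatrix Q v) :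
    IsAuMatrix Q (v.map f) :=
  (IsAuMatrix.congr f v).2 ⟨map_eq_one f h.1, map_eq_one f h.2, map_eq_one f h.3, map_eq_one f h.4⟩

theorem IsAuMatrix.of_map {F B : Type*} [Ring F] [StarRing F] [Algebra ℂ F] [Ring B] [StarRing B]
    [Algebra ℂ B] (f : F →⋆ₐ[ℂ] B) (hf : Function.Injective f) {v : Matrix (Fin n) (Fin n) F}
    (h : IsAuMatrix Q (v.map f)) : IsAuMatrix Q v := by
  have key {M : Matrix (Fin n) (Fin n) F} (hM : M.map f = 1) : M = 1 :=
    Matrix.map_injective hf (hM.trans (map_eq_one f rfl).symm)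
  obtain ⟨h1, h2, h3, h4⟩ := (IsAuMatrix.congr f v).1 h
  exact ⟨key h1, key h2, key h3, key h4⟩

/-- The product of two solutions of the relations of `A_u(Q)` with commuting entries is again a
solution. -/
theorem IsAuMatrix.mul {B : Type*} [Ring B] [StarRing B] [Algebra ℂ B]
    {v w : Matrix (Fin n) (Fin n) B} (hv : IsAuMatrix Q v) (hw : IsAuMatrix Q w)
    (hcomm : ∀ i j k l, Commute (v i j) (w k l)) : IsAuMatrix Q (v * w) := by
  have ht : (v * w)ᵀ = wᵀ * vᵀ := by
    ext i j
    simp only [Matrix.transpose_apply, Matrix.mul_apply]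
    exact Finset.sum_congr rfl fun k _ => (hcomm _ _ _ _).eq
  have hs : (v * w).map star = v.map star * w.map star := by
    ext i j
    simp only [Matrix.map_apply, Matrix.mul_apply, star_sum, star_mul]
    exact Finset.sum_congr rfl fun k _ => ((hcomm _ _ _ _).star_star).eq.symm
  have hQ : ((Q⁻¹ : GL (Fin n) ℂ) : Matrix (Fin n) (Fin n) ℂ).map (algebraMap ℂ B) *
      (Q : Matrix (Fin n) (Fin n) ℂ).map (algebraMap ℂ B) = 1 := by
    rw [← Matrix.map_mul, ← Units.val_mul, inv_mul_cancel, Units.val_one,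
      Matrix.map_one _ (map_zero _) (map_one _)]
  obtain ⟨v1, v2, v3, v4⟩ := hv
  obtain ⟨w1, w2, w3, w4⟩ := hw
  set P := (Q : Matrix (Fin n) (Fin n) ℂ).map (algebraMap ℂ B)
  set R := ((Q⁻¹ : GL (Fin n) ℂ) : Matrix (Fin n) (Fin n) ℂ).map (algebraMap ℂ B)
  -- Inserting `Q⁻¹ Q` between `v̄` and `w̄` brings out the relations of `v` and of `w`.
  have ins (X Y : Matrix (Fin n) (Fin n) B) : X * Y = X * R * (P * Y) := by
    rw [Matrix.mul_assoc, ← Matrix.mul_assoc R, hQ, Matrix.one_mul]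
  refine ⟨?_, ?_, ?_, ?_⟩
  · rw [Matrix.conjTranspose_mul, Matrix.mul_assoc, ← Matrix.mul_assoc _ v, v1, Matrix.one_mul, w1]
  · rw [Matrix.conjTranspose_mul, Matrix.mul_assoc, ← Matrix.mul_assoc w, w2, Matrix.one_mul, v2]
  · calc (v * w)ᵀ * P * (v * w).map star * R
        = wᵀ * (vᵀ * P * v.map star * R) * (P * w.map star) * R := by
          rw [ht, hs, ins (v.map star)]; simp only [Matrix.mul_assoc]
      _ = 1 := by rw [v3, Matrix.mul_one, ← Matrix.mul_assoc, w3]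
  · calc P * (v * w).map star * R * (v * w)ᵀ
        = P * v.map star * R * (P * w.map star * R * wᵀ) * vᵀ := by
          rw [ht, hs, ins (v.map star)]; simp only [Matrix.mul_assoc]
      _ = 1 := by rw [w4, Matrix.mul_one, v4]

/-- For a unitary `t` in a commutative `⋆`-algebra, the scalar matrix `t` solves the relations of `A_u(Q)`. -/
theorem IsAuMatrix.scalar {B : Type*} [CommRing B] [StarRing B] [Algebra ℂ B] {t : B}
    (ht : star t * t = 1) : IsAuMatrix Q (Matrix.scalar (Fin n) t) := by
  have ht' : t * star t = 1 := by rw [mul_comm, ht]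
  have h1 : Matrix.scalar (Fin n) t = t • 1 := Matrix.smul_one_eq_diagonal t |>.symm
  have h2 : (Matrix.scalar (Fin n) t).map star = star t • 1 := by
    rw [Matrix.smul_one_eq_diagonal]
    ext i j
    by_cases h : i = j <;> simp [h]
  have h3 : (Matrix.scalar (Fin n) t)ᴴ = star t • 1 := by
    rw [Matrix.smul_one_eq_diagonal]
    simp [Matrix.diagonal_conjTranspose]
  refine ⟨?_, ?_, ?_, ?_⟩
  · rw [h3, h1]; simp [smul_smul, ht']
  · rw [h3, h1]; simp [smul_smul, ht]
  · rw [h2, h1]; simp [smul_smul, ht]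
  · rw [h2, h1]; simp [smul_smul, ht']

variable (Q)

theorem Au.exists_comul : ∃ Δ : Au Q →⋆ₐ[ℂ] MinTensor (Au Q) (Au Q),
    ∀ i j, Δ (Au.u Q i j) = ∑ k, tmul (Au.u Q i k) (Au.u Q k j) := by
  obtain ⟨Δ, hΔ⟩ := Au.exists_lift Q _
    (((Au.isAuMatrix_u Q).map (tmulLeft (Au Q) (Au Q))).mul
      ((Au.isAuMatrix_u Q).map (tmulRight (Au Q) (Au Q)))
      fun i j k l => by
        simp only [Matrix.map_apply, tmulLeft_apply, tmulRight_apply, Commute, SemiconjBy,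
          tmul_mul_tmul, one_mul, mul_one])
  refine ⟨Δ, fun i j => (hΔ i j).trans ?_⟩
  simp only [Matrix.mul_apply, Matrix.map_apply, tmulLeft_apply, tmulRight_apply, tmul_mul_tmul,
    one_mul, mul_one]

/-- The universal property of `A_u(Q)` on the `⋆`-algebra generated by the coefficients: the
relations hold there, so that `A_u(Q)` is full. -/
theorem Au.exists_extension {D : Type} [CStarAlgebra D]
    (φ : coeffAlg {(⟨n, Au.u Q⟩ : Σ d : ℕ, Matrix (Fin d) (Fin d) (Au Q))} →⋆ₐ[ℂ] D) :
    ∃ ψ : Au Q →⋆ₐ[ℂ] D, ∀ i j,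
      ψ (Au.u Q i j) = φ ⟨Au.u Q i j, mem_coeffAlg_singleton (Au.u Q) i j⟩ := by
  let w : Matrix (Fin n) (Fin n)
      (coeffAlg {(⟨n, Au.u Q⟩ : Σ d : ℕ, Matrix (Fin d) (Fin d) (Au Q))}) :=
    Matrix.of fun i j => ⟨Au.u Q i j, mem_coeffAlg_singleton (Au.u Q) i j⟩
  have hw : IsAuMatrix Q w :=
    IsAuMatrix.of_map (v := w)
      (coeffAlg {(⟨n, Au.u Q⟩ : Σ d : ℕ, Matrix (Fin d) (Fin d) (Au Q))}).subtype
      Subtype.val_injective (Au.isAuMatrix_u Q)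
  exact Au.exists_lift Q _ (hw.map φ)

theorem Au.isUnit_conj : IsUnit ((Au.u Q).map star) := by
  have h := Au.isAuMatrix_u Q
  obtain ⟨-, -, h3, h4⟩ := h
  set P := (Q : Matrix (Fin n) (Fin n) ℂ).map (algebraMap ℂ (Au Q))
  set R := ((Q⁻¹ : GL (Fin n) ℂ) : Matrix (Fin n) (Fin n) ℂ).map (algebraMap ℂ (Au Q))
  have hPR : P * R = 1 := by
    rw [← Matrix.map_mul, ← Units.val_mul, mul_inv_cancel, Units.val_one,
      Matrix.map_one _ (map_zero _) (map_one _)]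
  have hRP : R * P = 1 := by
    rw [← Matrix.map_mul, ← Units.val_mul, inv_mul_cancel, Units.val_one,
      Matrix.map_one _ (map_zero _) (map_one _)]
  refine ⟨⟨(Au.u Q).map star, R * (Au.u Q)ᵀ * P, ?_, ?_⟩, rfl⟩
  · calc (Au.u Q).map star * (R * (Au.u Q)ᵀ * P)
        = R * P * ((Au.u Q).map star * (R * (Au.u Q)ᵀ * P)) := by rw [hRP, Matrix.one_mul]
      _ = R * (P * (Au.u Q).map star * R * (Au.u Q)ᵀ) * P := by simp only [Matrix.mul_assoc]
      _ = 1 := by rw [h4, Matrix.mul_one, hRP]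
  · calc R * (Au.u Q)ᵀ * P * (Au.u Q).map star
        = R * (Au.u Q)ᵀ * P * (Au.u Q).map star * (R * P) := by rw [hRP, Matrix.mul_one]
      _ = R * ((Au.u Q)ᵀ * P * (Au.u Q).map star * R) * P := by simp only [Matrix.mul_assoc]
      _ = 1 := by rw [h3, Matrix.mul_one, hRP]

/-- `A_u(Q)` is the algebra of functions on a compact quantum group with fundamental
representation `u`. -/
theorem Au.exists_compactQuantumGroup [Nontrivial (Au Q)] :
    ∃ G : CompactQuantumGroup (Au Q),
      ∀ i j, G.comul (Au.u Q i j) = ∑ k, tmul (Au.u Q i k) (Au.u Q k j) := by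
  obtain ⟨Δ, hΔ⟩ := Au.exists_comul Q
  exact ⟨.ofMatrix Δ (Au.u Q)
    ⟨(Au.isAuMatrix_u Q).star_mul_self, (Au.isAuMatrix_u Q).mul_star_self, hΔ⟩
    (Au.isUnit_conj Q) (Au.dense_adjoin Q) fun D _ φ => Au.exists_extension Q φ, hΔ⟩

end Au

/-! ### The circle group -/

theorem star_circleCoord_mul_self : star circleCoord * circleCoord = 1 := by
  ext z
  change star (z : ℂ) * z = 1
  rw [Complex.star_def, ← Complex.normSq_eq_conj_mul_self, Circle.normSq_coe, Complex.ofReal_one]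

theorem dense_adjoin_circleCoord :
    Dense (StarAlgebra.adjoin ℂ {circleCoord} : Set C(Circle, ℂ)) := by
  have h := ContinuousMap.starSubalgebra_topologicalClosure_eq_top_of_separatesPoints
    (StarAlgebra.adjoin ℂ {circleCoord}) fun x y hxy =>
      ⟨circleCoord, ⟨circleCoord, StarAlgebra.self_mem_adjoin_singleton ℂ _, rfl⟩,
        fun h => hxy (Circle.ext h)⟩
  rw [dense_iff_closure_eq, ← StarSubalgebra.topologicalClosure_coe, h]
  rfl

/-- `C(𝕋)` is the universal C⋆-algebra generated by a unitary: continuous functional calculus on the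
circle, which contains the spectrum of any unitary. -/
theorem exists_circleLift {D : Type*} [CStarAlgebra D] {w : D} (h1 : star w * w = 1)
    (h2 : w * star w = 1) : ∃ φ : C(Circle, ℂ) →⋆ₐ[ℂ] D, φ circleCoord = w := by
  have hw : w ∈ unitary D := ⟨h1, h2⟩
  have hn : IsStarNormal w := ⟨by rw [Commute, SemiconjBy, h1, h2]⟩
  let ι : C(spectrum ℂ w, Circle) :=
    ⟨fun z => ⟨z, by
      have : ‖(z : ℂ)‖ = 1 := spectrum.norm_eq_one_of_unitary hw z.2
      simpa [Submonoid.unitSphere] using this⟩, by fun_prop⟩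
  refine ⟨(cfcHom hn).comp (ContinuousMap.compStarAlgHom' ℂ ℂ ι), ?_⟩
  exact cfcHom_id hn

theorem exists_circle_comul : ∃ Δ : C(Circle, ℂ) →⋆ₐ[ℂ] MinTensor C(Circle, ℂ) C(Circle, ℂ),
    Δ circleCoord = tmul circleCoord circleCoord := by
  have h := star_circleCoord_mul_self
  refine exists_circleLift ?_ ?_ <;> rw [star_tmul, tmul_mul_tmul]
  · rw [h, one_tmul_one]
  · rw [mul_comm, h, one_tmul_one]

theorem exists_circle_compactQuantumGroup : ∃ T : CompactQuantumGroup C(Circle, ℂ),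
    T.comul circleCoord = tmul circleCoord circleCoord := by
  obtain ⟨Δ, hΔ⟩ := exists_circle_comul
  have h := star_circleCoord_mul_self
  have h' : circleCoord * star circleCoord = 1 := by rw [mul_comm, h]
  let v : Matrix (Fin 1) (Fin 1) C(Circle, ℂ) := Matrix.of fun _ _ => circleCoord
  refine ⟨.ofMatrix Δ v ⟨?_, ?_, fun i j => ?_⟩ ⟨⟨v.map star, v, ?_, ?_⟩, rfl⟩ ?_
    fun D _ φ => ?_, hΔ⟩
  · exact matrix_fin_one_eq_one (by simpa [Matrix.mul_apply, v] using h)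
  · exact matrix_fin_one_eq_one (by simpa [Matrix.mul_apply, v] using h')
  · simpa [v] using hΔ
  · exact matrix_fin_one_eq_one (by simpa [Matrix.mul_apply, v] using h)
  · exact matrix_fin_one_eq_one (by simpa [Matrix.mul_apply, v] using h')
  · have : {a | ∃ i j, a = v i j} = {circleCoord} := by ext a; simp [v]
    rw [this]
    exact dense_adjoin_circleCoord
  · obtain ⟨ψ, hψ⟩ := exists_circleLift
      (w := φ ⟨circleCoord, mem_coeffAlg_singleton v 0 0⟩)
      (by
        rw [← map_star, ← map_mul, ← map_one φ]
        exact congrArg φ (Subtype.ext h))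
      (by
        rw [← map_star, ← map_mul, ← map_one φ]
        exact congrArg φ (Subtype.ext h'))
    exact ⟨ψ, fun _ _ => hψ⟩

/-- A continuous function on a connected space that lies in a finite dimensional algebra of functions
is constant, since it takes its values among the roots of a polynomial. -/
theorem eq_algebraMap_of_mem_finiteDimensional {X : Type*} [TopologicalSpace X] [CompactSpace X]
    [ConnectedSpace X] (S : StarSubalgebra ℂ C(X, ℂ)) [FiniteDimensional ℂ S]
    {f : C(X, ℂ)} (hf : f ∈ S) : ∃ c : ℂ, f = algebraMap ℂ C(X, ℂ) c := by
  obtain ⟨p, hp, hpf⟩ := Algebra.IsIntegral.isIntegral (R := ℂ) (⟨f, hf⟩ : S)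
  have hpf' : Polynomial.aeval f p = 0 := by
    have := congrArg S.subtype.toAlgHom hpf
    rw [← Polynomial.aeval_def] at this
    rw [map_zero, ← Polynomial.aeval_algHom_apply] at this
    exact this
  have hfin : (Set.range f).Finite := by
    refine (p.roots.toFinset.finite_toSet).subset ?_
    rintro _ ⟨x, rfl⟩
    have := congrArg (ContinuousMap.evalAlgHom ℂ ℂ x) hpf'
    rw [map_zero, ← Polynomial.aeval_algHom_apply, Polynomial.coe_aeval_eq_eval] at this
    simpa [hp.ne_zero] using this
  have hsub : (Set.range f).Subsingleton :=
    hfin.countable.isTotallyDisconnected _ le_rfl (isPreconnected_range f.continuous)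
  obtain ⟨x₀⟩ := (inferInstance : Nonempty X)
  exact ⟨f x₀, ContinuousMap.ext fun x => hsub ⟨x, rfl⟩ ⟨x₀, rfl⟩⟩

/-- A representation with constant coefficients is trivial: its constant matrix `M` is unitary and
satisfies `M * M = M`. -/
theorem eq_one_of_constant_coefficients {A : Type*} [CStarAlgebra A]
    [Nontrivial (MinTensor A A)] {Δ : A →⋆ₐ[ℂ] MinTensor A A} {d : ℕ}
    {v : Matrix (Fin d) (Fin d) A} (hv : IsUnitaryRep Δ v)
    (hconst : ∀ i j, ∃ c : ℂ, v i j = algebraMap ℂ A c) : v = 1 := by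
  choose M hM using hconst
  have hMM : Matrix.of M * Matrix.of M = Matrix.of M := by
    ext i j
    refine (algebraMap ℂ (MinTensor A A)).injective ?_
    have h := hv.comul_apply i j
    simp only [hM, Algebra.algebraMap_eq_smul_one, map_smul, map_one, smul_tmul_smul,
      one_tmul_one] at h
    rw [← Finset.sum_smul] at h
    simpa only [Matrix.mul_apply, Matrix.of_apply, Algebra.algebraMap_eq_smul_one] using h.symm
  have hv' : v = (Matrix.of M).map (algebraMap ℂ A) := by ext1 i j; exact hM i j
  have hvv : v * v = v := by rw [hv', ← Matrix.map_mul, hMM]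
  calc v = vᴴ * v * v := by rw [hv.star_mul_self, Matrix.one_mul]
    _ = 1 := by rw [Matrix.mul_assoc, hvv, hv.star_mul_self]

theorem circle_isConnected (T : CompactQuantumGroup C(Circle, ℂ)) : T.IsConnected := by
  intro d v hv _ hne hfin
  let χ : C(Circle, ℂ) →⋆ₐ[ℂ] ℂ := ContinuousMap.evalStarAlgHom ℂ ℂ 1
  have := nontrivial_minTensor χ χ
  refine hne (eq_one_of_constant_coefficients hv fun i j =>
    eq_algebraMap_of_mem_finiteDimensional
      (StarAlgebra.adjoin ℂ {a | ∃ i j, a = v i j}).topologicalClosure ?_)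
  exact StarSubalgebra.le_topologicalClosure _ (StarAlgebra.subset_adjoin ℂ _ ⟨i, j, rfl⟩)

/-! ### Central quantum subgroups and the circle in `A_u(Q)` -/

/-- Centrality identifies `(π ⊗ id) Δ` with the flip of `(id ⊗ π) Δ`, so that the two quotient
algebras coincide. -/
theorem CompactQuantumGroup.IsCentral.isNormal {A B : Type u} [CStarAlgebra A] [CStarAlgebra B]
    {G : CompactQuantumGroup A} {π : A →⋆ₐ[ℂ] B} (h : G.IsCentral π) : G.IsNormal π := by
  ext a
  change map (StarAlgHom.id ℂ A) π (G.comul a) = tmul a 1 ↔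
    map π (StarAlgHom.id ℂ A) (G.comul a) = tmul 1 a
  rw [h a, ← flip_map, ← flip_tmul a (1 : B)]
  exact ⟨congrArg _, fun h => by simpa only [flip_flip] using congrArg (flip B A) h⟩

section

variable {n : ℕ} (Q : GL (Fin n) ℂ)

theorem Au.exists_toCircle : ∃ π : Au Q →⋆ₐ[ℂ] C(Circle, ℂ),
    ∀ i j, π (Au.u Q i j) = if i = j then circleCoord else 0 := by
  obtain ⟨π, hπ⟩ := Au.exists_lift Q _ (IsAuMatrix.scalar star_circleCoord_mul_self)
  exact ⟨π, fun i j => by rw [hπ, Matrix.scalar_apply, Matrix.diagonal_apply]⟩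

variable {Q} {G : CompactQuantumGroup (Au Q)} {T : CompactQuantumGroup C(Circle, ℂ)}
  {π : Au Q →⋆ₐ[ℂ] C(Circle, ℂ)}

theorem Au.map_toCircle_id_comul
    (hG : ∀ i j, G.comul (Au.u Q i j) = ∑ k, tmul (Au.u Q i k) (Au.u Q k j))
    (hπ : ∀ i j, π (Au.u Q i j) = if i = j then circleCoord else 0) (i j : Fin n) :
    map π (StarAlgHom.id ℂ (Au Q)) (G.comul (Au.u Q i j)) = tmul circleCoord (Au.u Q i j) := by
  rw [hG, map_sum, Finset.sum_eq_single i]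
  · rw [map_tmul, hπ, if_pos rfl]; rfl
  · intro k _ hk
    rw [map_tmul, hπ, if_neg hk.symm, zero_tmul]
  · simp

theorem Au.isCentral_toCircle
    (hG : ∀ i j, G.comul (Au.u Q i j) = ∑ k, tmul (Au.u Q i k) (Au.u Q k j))
    (hπ : ∀ i j, π (Au.u Q i j) = if i = j then circleCoord else 0) : G.IsCentral π := by
  have key : (map π (StarAlgHom.id ℂ (Au Q))).comp G.comul =
      ((map π (StarAlgHom.id ℂ (Au Q))).comp (flip (Au Q) (Au Q))).comp G.comul := by
    refine starAlgHom_ext_of_dense_adjoin (Au.dense_adjoin Q) ?_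
    rintro _ ⟨i, j, rfl⟩
    change map π (StarAlgHom.id ℂ (Au Q)) (G.comul (Au.u Q i j)) =
      map π (StarAlgHom.id ℂ (Au Q)) (flip (Au Q) (Au Q) (G.comul (Au.u Q i j)))
    rw [Au.map_toCircle_id_comul hG hπ, hG, map_sum, map_sum, Finset.sum_eq_single j]
    · rw [flip_tmul, map_tmul, hπ, if_pos rfl]; rfl
    · intro k _ hk
      rw [flip_tmul, map_tmul, hπ, if_neg hk, zero_tmul]
    · simp
  exact fun a => DFunLike.congr_fun key a

theorem Au.surjective_toCircle (i : Fin n)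
    (hπ : ∀ i j, π (Au.u Q i j) = if i = j then circleCoord else 0) : Function.Surjective π := by
  refine surjective_of_denseRange π (dense_adjoin_circleCoord.mono ?_)
  have : StarAlgebra.adjoin ℂ {circleCoord} ≤ π.range :=
    StarAlgebra.adjoin_le (by
      rw [Set.singleton_subset_iff]
      exact ⟨Au.u Q i i, (hπ i i).trans (if_pos rfl)⟩)
  exact this

theorem Au.isQuantumSubgroup_toCircle (i : Fin n)
    (hG : ∀ i j, G.comul (Au.u Q i j) = ∑ k, tmul (Au.u Q i k) (Au.u Q k j))
    (hT : T.comul circleCoord = tmul circleCoord circleCoord)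
    (hπ : ∀ i j, π (Au.u Q i j) = if i = j then circleCoord else 0) :
    CompactQuantumGroup.IsQuantumSubgroup G T π := by
  refine ⟨Au.surjective_toCircle i hπ, ?_⟩
  have key : (map π π).comp G.comul = T.comul.comp π := by
    refine starAlgHom_ext_of_dense_adjoin (Au.dense_adjoin Q) ?_
    rintro _ ⟨i, j, rfl⟩
    change map π π (G.comul (Au.u Q i j)) = T.comul (π (Au.u Q i j))
    rw [hG, map_sum, Finset.sum_eq_single i]
    · rw [map_tmul, hπ, hπ, if_pos rfl]
      split_ifs
      · rw [hT]
      · rw [tmul_zero, map_zero]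
    · intro k _ hk
      rw [map_tmul, hπ i k, if_neg hk.symm, zero_tmul]
    · simp
  exact fun a => DFunLike.congr_fun key a

theorem circleCoord_ne_algebraMap (c : ℂ) : circleCoord ≠ algebraMap ℂ C(Circle, ℂ) c := by
  intro h
  have h1 : ((1 : Circle) : ℂ) = c := DFunLike.congr_fun h 1
  have h2 : ((-1 : Circle) : ℂ) = c := DFunLike.congr_fun h (-1)
  rw [← h1] at h2
  norm_num [Circle.coe_neg] at h2

/-- If `A_u(Q)` were simple, then the central circle would be all of it, `u` would be a scalar matrix,
and its diagonal entry a nontrivial one dimensional representation. -/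
theorem Au.not_isSimple (i : Fin n)
    (hG : ∀ i j, G.comul (Au.u Q i j) = ∑ k, tmul (Au.u Q i k) (Au.u Q k j))
    (hT : T.comul circleCoord = tmul circleCoord circleCoord)
    (hπ : ∀ i j, π (Au.u Q i j) = if i = j then circleCoord else 0) : ¬ G.IsSimple := by
  intro hs
  rcases hs.normal_trivial _ T π (Au.isQuantumSubgroup_toCircle i hG hT hπ)
    (Au.isCentral_toCircle hG hπ).isNormal (circle_isConnected T) with h | h
  · obtain ⟨c, hc⟩ := h circleCoord
    exact circleCoord_ne_algebraMap c hc
  · have hii : π (Au.u Q i i) = circleCoord := by rw [hπ, if_pos rfl]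
    have h1 : star (Au.u Q i i) * Au.u Q i i = 1 := h <| by
      rw [map_mul, map_star, hii, star_circleCoord_mul_self, map_one]
    have h2 : Au.u Q i i * star (Au.u Q i i) = 1 := h <| by
      rw [map_mul, map_star, hii, mul_comm, star_circleCoord_mul_self, map_one]
    have h3 : G.comul (Au.u Q i i) = tmul (Au.u Q i i) (Au.u Q i i) := by
      rw [hG, Finset.sum_eq_single i]
      · intro k _ hk
        have : Au.u Q i k = 0 := h <| by rw [hπ, if_neg hk.symm, map_zero]
        rw [this, zero_tmul]
      · simp
    let v : Matrix (Fin 1) (Fin 1) (Au Q) := Matrix.of fun _ _ => Au.u Q i i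
    have hv : v = 1 := by
      refine hs.one_dim_trivial v ⟨?_, ?_, fun a b => ?_⟩
      · exact matrix_fin_one_eq_one (by simpa [Matrix.mul_apply, v] using h1)
      · exact matrix_fin_one_eq_one (by simpa [Matrix.mul_apply, v] using h2)
      · simpa [v] using h3
    have h4 : Au.u Q i i = 1 := congrFun (congrFun hv 0) 0
    refine circleCoord_ne_algebraMap 1 ?_
    rw [← hii, h4, map_one, map_one]

end

end QuantumGroup

theorem mainTheorem10 (n : ℕ) (hn : 1 ≤ n) (Q : GL (Fin n) ℂ) :
    ∃ G : QuantumGroup.CompactQuantumGroup (QuantumGroup.Au Q),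
      (∀ i j, G.comul (QuantumGroup.Au.u Q i j) =
        ∑ k, QuantumGroup.tmul (QuantumGroup.Au.u Q i k) (QuantumGroup.Au.u Q k j)) ∧
      ¬ G.IsSimple ∧
      ∃ T : QuantumGroup.CompactQuantumGroup C(Circle, ℂ),
        T.comul QuantumGroup.circleCoord =
          QuantumGroup.tmul QuantumGroup.circleCoord QuantumGroup.circleCoord ∧
        T.IsConnected ∧
        ∃ π : QuantumGroup.Au Q →⋆ₐ[ℂ] C(Circle, ℂ),
          (∀ i j, π (QuantumGroup.Au.u Q i j) = if i = j then QuantumGroup.circleCoord else 0) ∧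
          QuantumGroup.CompactQuantumGroup.IsQuantumSubgroup G T π ∧
          G.IsCentral π ∧ G.IsNormal π := by
  obtain ⟨π, hπ⟩ := QuantumGroup.Au.exists_toCircle Q
  have : Nontrivial (QuantumGroup.Au Q) := π.toAlgHom.toRingHom.domain_nontrivial
  obtain ⟨G, hG⟩ := QuantumGroup.Au.exists_compactQuantumGroup Q
  obtain ⟨T, hT⟩ := QuantumGroup.exists_circle_compactQuantumGroup
  have hcentral := QuantumGroup.Au.isCentral_toCircle hG hπ
  let i : Fin n := ⟨0, hn⟩
  exact ⟨G, hG, QuantumGroup.Au.not_isSimple i hG hT hπ, T, hT,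
    QuantumGroup.circle_isConnected T, π, hπ,
    QuantumGroup.Au.isQuantumSubgroup_toCircle i hG hT hπ, hcentral, hcentral.isNormal⟩
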